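/- **Setting.** Let $\mathrm{Homeo}^{\sim}_+(S^1)$ be the group of homeomorphisms $\alpha$ of $\mathbb R$ with $\alpha(x+1)=\alpha(x)+1$ for all $x$. Identify $\mathbb R/\mathbb Z$ with the real projective line by $x\mapsto[\cos \pi x:\sin \pi x]$, and let $\mathrm{PSL}_2(\mathbb R)$ act on it through its linear action on $\mathbb R^2$. Let $\widetilde{\mathrm{SL}}_2(\mathbb R)\subseteq \mathrm{Homeo}^{\sim}_+(S^1)$ be the subgroup of those $\alpha$ that induce on $\mathbb R/\mathbb Z$ the action of some (necessarily unique) $\overline\alpha\in \mathrm{PSL}_2(\mathbb R)$. Every $g\in\mathrm{PSL}_2(\mathbb R)$ has a unique lift $\widetilde g$ with $\widetilde g(0)\in[0,1)$. Put $T_u(x)=x+u$ and $$\rho_\theta=\begin{bmatrix}\cos\theta&-\sin\theta\\ \sin\theta&\cos\theta\end{bmatrix},\qquad a_\lambda=\begin{bmatrix}\lambda&0\\0&1/\lambda\end{bmatrix},\qquad u_x=\begin{bmatrix}1&x\\0&1\end{bmatrix}.$$ For $\alpha\in\mathrm{Homeo}^{\sim}_+(S^1)$ define the following. - $\ell(\alpha)=\sup_{t\in[0,1]}|\alpha(t)-t|$,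 and $\ell^\sharp(\alpha)$ is the class of $\ell(\alpha)$ in $\mathbb R^\sharp=\{\dots,[0],[(0,1)],[1],[(1,2)],\dots\}$, the quotient of $\mathbb R$ whose classes are the single integers and the open intervals between consecutive integers. - $\tau(\alpha)=\lim_{n\to\infty}(\alpha^n(x)-x)/n$, which does not depend on $x$. - $\sigma(\alpha)$ is the sign of $\tau(\alpha)$ if $\tau(\alpha)\ne0$. If $\tau(\alpha)=0$ and $\alpha\neq\mathrm{id}$, then $\sigma(\alpha)=1$ if $\tau(T_\varepsilon\alpha)>0$ for all $\varepsilon>0$, $\sigma(\alpha)=-1$ if $\tau(T_{-\varepsilon}\alpha)<0$ for all $\varepsilon>0$, and $\sigma(\alpha)=0$ otherwise. - The direction type of $\alpha\ne\mathrm{id}$ is the pair consisting of $1$ or $0$, according as $\tau(\alpha)\neq0$ or $\tau(\alpha)=0$, and $\sigma(\alpha)$. The identity has a type of its own. For $g=\begin{bmatrix}a&b\\c&d\end{bmatrix}\in\mathrm{PSL}_2(\mathbb R)$ put $\overline{\mathrm{tr}}(g)=|a+d|$. **Theorem.** 1. Every conjugacy class of $\widetilde{\mathrm{SL}}_2(\mathbb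 R)$ is exactly one of $[T_k]$, $[T_k\widetilde u_1]$, $[T_k\widetilde u_{-1}]$, $[T_k\widetilde a_\lambda]$, $[T_k\widetilde\rho_\theta]$ with $k\in\mathbb Z$, $\lambda>1$, $0<\theta<\pi$, and different kinds or parameters give different classes. 2. $\ell^\sharp$ is constant on each of these classes, with the following values, for all $n\ge1$, $\lambda>1$, $0<\theta<\pi$: - $[0]$ on $[\mathrm{id}]$; - $[(0,1)]$ on $[\widetilde u_1]$, $[\widetilde u_{-1}]$, $[\widetilde a_\lambda]$, $[\widetilde\rho_\theta]$, $[T_{-1}\widetilde\rho_\theta]$; - $[n]$ on $[T_n]$, $[T_{-n}]$, $[T_n\widetilde u_1]$, $[T_{-n}\widetilde u_{-1}]$; - $[(n,n+1)]$ on $[T_{-n}\widetilde u_1]$, $[T_n\widetilde u_{-1}]$, $[T_n\widetilde a_\lambda]$, $[T_{-n}\widetilde a_\lambda]$, $[T_n\widetilde\rho_\theta]$, $[T_{-1-n}\widetilde\rho_\theta]$. 3. Let $\alpha,\beta\in\widetilde{\mathrm{SL}}_2(\mathbb R)$ be non-central. - If $\overline{\mathrm{tr}}(\overline\alpha)\ge2$,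 then $\alpha$ and $\beta$ are conjugate if and only if they have the same $\overline{\mathrm{tr}}$, the same direction type and the same $\ell^\sharp$. - If $\overline{\mathrm{tr}}(\overline\alpha)<2$, then $\alpha$ and $\beta$ have the same three invariants if and only if, for some $k\in\mathbb Z$ and $\theta\in(0,\pi)$, $\alpha$ is conjugate to $T_k\widetilde\rho_\theta$ and $\beta$ is conjugate to $T_k\widetilde\rho_\theta$ or to $T_k\widetilde\rho_{\pi-\theta}$. -/

import Mathlib

open scoped MatrixGroups

namespace SL2Cover

noncomputable section

/-! ### Lifts to the line of orientation-preserving homeomorphisms of the circle -/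

/-- The group of all homeomorphisms `α` of `ℝ` with `α (x + 1) = α x + 1` for all `x`, under
composition: the lifts of orientation-preserving homeomorphisms of `ℝ / ℤ`.
(An invertible monotone map of degree one is the same thing, see `exists_coe_eq_iff`.) -/
abbrev HomeoTilde : Type := CircleDeg1Liftˣ

lemma exists_coe_eq_of_injective {f : ℝ → ℝ} (hc : Continuous f) (hi : Function.Injective f)
    (h1 : ∀ x, f (x + 1) = f x + 1) : ∃ α : HomeoTilde, ⇑α = f := by
  have hm : StrictMono f := by
    rcases hc.strictMono_of_inj hi with h | h
    · exact h
    · have := h (show (0 : ℝ) < 0 + 1 by norm_num)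
      rw [h1] at this
      linarith
  let F : CircleDeg1Lift := ⟨⟨f, hm.monotone⟩, h1⟩
  have hs : Function.Surjective F := F.continuous_iff_surjective.1 hc
  obtain ⟨u, hu⟩ := CircleDeg1Lift.isUnit_iff_bijective.2 ⟨hi, hs⟩
  exact ⟨u, by rw [hu]; rfl⟩

lemma exists_coe_eq_iff (f : ℝ → ℝ) :
    (∃ α : HomeoTilde, ⇑α = f) ↔ IsHomeomorph f ∧ ∀ x, f (x + 1) = f x + 1 := by
  constructor
  · rintro ⟨α, rfl⟩
    exact ⟨(CircleDeg1Lift.toOrderIso α).toHomeomorph.isHomeomorph,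
      (α : CircleDeg1Lift).map_add_one⟩
  · rintro ⟨h, h1⟩
    exact exists_coe_eq_of_injective h.continuous h.injective h1

/-! ### Invariants of elements of `HomeoTilde` -/

/-- The translation number `lim (α ^ n x - x) / n`. -/
def tau (α : HomeoTilde) : ℝ := CircleDeg1Lift.translationNumber α

/-- The translation `x ↦ u + x`. -/
def trans (u : ℝ) : HomeoTilde := CircleDeg1Lift.translate (Multiplicative.ofAdd u)

open Classical in
/-- The translation direction. -/
def sigma (α : HomeoTilde) : SignType :=
  if 0 < |tau α| then SignType.sign (tau α)
  else if α ≠ 1 ∧ tau α = 0 ∧ ∀ ε : ℝ, 0 < ε → 0 < tau (trans ε * α) then 1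
  else if α ≠ 1 ∧ tau α = 0 ∧ ∀ ε : ℝ, 0 < ε → tau (trans (-ε) * α) < 0 then -1
  else 0

open Classical in
/-- The direction type: `none` for the identity; otherwise the pair whose first entry is `1` or `0`
according as the translation number is non-zero or zero, and whose second entry is the translation
direction. Thus `(1, 1)` is forward, `(0, 1)` semi-forward, `(0, 0)` alternating,
`(0, -1)` semi-backward and `(1, -1)` backward. -/
def directionType (α : HomeoTilde) : Option (SignType × SignType) :=
  if α = 1 then none else some (SignType.sign |tau α|, sigma α)

/-- The displacement length `sup_{t ∈ [0, 1]} |α t - t|`. -/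
def length (α : HomeoTilde) : ℝ := ⨆ t : Set.Icc (0 : ℝ) 1, |α t - t|

/-- Two reals are identified when they are the same integer, or lie in the same open interval
between consecutive integers. -/
def sharpSetoid : Setoid ℝ where
  r x y := (x = y ∧ ∃ k : ℤ, x = k) ∨
    ∃ k : ℤ, x ∈ Set.Ioo (k : ℝ) (k + 1) ∧ y ∈ Set.Ioo (k : ℝ) (k + 1)
  iseqv := by
    refine ⟨fun x => ?_, ?_, ?_⟩
    · by_cases h : (⌊x⌋ : ℝ) = x
      · exact Or.inl ⟨rfl, ⌊x⌋, h.symm⟩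
      · have : x ∈ Set.Ioo (⌊x⌋ : ℝ) (⌊x⌋ + 1) :=
          ⟨lt_of_le_of_ne (Int.floor_le x) h, Int.lt_floor_add_one x⟩
        exact Or.inr ⟨⌊x⌋, this, this⟩
    · rintro x y (⟨rfl, h⟩ | ⟨k, h1, h2⟩)
      · exact Or.inl ⟨rfl, h⟩
      · exact Or.inr ⟨k, h2, h1⟩
    · rintro x y z (⟨rfl, h⟩ | ⟨k, h1, h2⟩) h'
      · exact h'
      · rcases h' with ⟨rfl, m, _⟩ | ⟨m, h3, h4⟩
        · exact Or.inr ⟨k, h1, h2⟩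
        · have e : k = m := (Int.floor_eq_iff.2 ⟨h2.1.le, h2.2⟩).symm.trans
            (Int.floor_eq_iff.2 ⟨h3.1.le, h3.2⟩)
          subst e
          exact Or.inr ⟨k, h1, h4⟩

/-- The quotient set `ℝ♯ = {…, [0], [(0,1)], [1], [(1,2)], …}`. -/
def RSharp : Type := Quotient sharpSetoid

/-- The class `x♯` of a real number. -/
def sharp (x : ℝ) : RSharp := Quotient.mk sharpSetoid x

/-- The class `[n]` of an integer. -/
def sharpInt (n : ℤ) : RSharp := sharp n

/-- The class `[(n, n + 1)]`, represented by the midpoint of the interval. -/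
def sharpIoo (n : ℤ) : RSharp := sharp (n + 1 / 2)

/-- The invariant `ℓ♯`. -/
def lengthSharp (α : HomeoTilde) : RSharp := sharp (length α)

/-! ### The projective line as `ℝ / ℤ`, and lifts of elements of `PSL(2, ℝ)` -/

/-- The real projective line. -/
abbrev RP1 : Type := Projectivization ℝ (Fin 2 → ℝ)

lemma dirVec_ne_zero (x : ℝ) : ![Real.cos (Real.pi * x), Real.sin (Real.pi * x)] ≠ 0 := by
  intro h
  have h0 := congrFun h 0
  have h1 := congrFun h 1
  simp at h0 h1
  have := Real.sin_sq_add_cos_sq (Real.pi * x)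
  rw [h0, h1] at this
  norm_num at this

/-- The line in `ℝ²` at angle `π x`. This map induces the identification of `ℝ / ℤ` with the real
projective line, see `linePt_eq_iff` and `linePt_surjective`. -/
def linePt (x : ℝ) : RP1 :=
  Projectivization.mk ℝ ![Real.cos (Real.pi * x), Real.sin (Real.pi * x)] (dirVec_ne_zero x)

lemma linePt_eq_iff (x y : ℝ) : linePt x = linePt y ↔ ∃ k : ℤ, x = y + k := by
  unfold linePt
  rw [Projectivization.mk_eq_mk_iff']
  constructor
  · rintro ⟨a, ha⟩
    have h0 := congrFun ha 0
    have h1 := congrFun ha 1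
    simp at h0 h1
    have : Real.sin (Real.pi * x - Real.pi * y) = 0 := by
      rw [Real.sin_sub, ← h0, ← h1]; ring
    obtain ⟨n, hn⟩ := Real.sin_eq_zero_iff.1 this
    refine ⟨n, ?_⟩
    have := Real.pi_ne_zero
    have h : Real.pi * (x - y - n) = 0 := by linarith
    rcases mul_eq_zero.1 h with h | h
    · contradiction
    · linarith
  · rintro ⟨k, rfl⟩
    refine ⟨(-1) ^ k, ?_⟩
    ext i
    fin_cases i
    · simp [mul_add, mul_comm Real.pi (k : ℝ), Real.cos_add_int_mul_pi]
    · simp [mul_add, mul_comm Real.pi (k : ℝ), Real.sin_add_int_mul_pi]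

lemma linePt_surjective : Function.Surjective linePt := by
  intro p
  induction p using Projectivization.ind with | _ v hv =>
  let z : ℂ := ⟨v 0, v 1⟩
  have hz : z ≠ 0 := by
    intro h
    apply hv
    ext i
    fin_cases i
    · exact congrArg Complex.re h
    · exact congrArg Complex.im h
  refine ⟨z.arg / Real.pi, ?_⟩
  have hp := Real.pi_ne_zero
  unfold linePt
  rw [Projectivization.mk_eq_mk_iff']
  refine ⟨‖z‖⁻¹, ?_⟩
  have e : Real.pi * (z.arg / Real.pi) = z.arg := by field_simp
  rw [e]
  ext i
  fin_cases i
  · simp [Complex.cos_arg hz, z, div_eq_inv_mul]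
  · simp [Complex.sin_arg, z, div_eq_inv_mul]

/-- `α` is a lift of the homeomorphism of `ℝ / ℤ ≃ RP1` given by the action of `g`. -/
def IsLift (α : HomeoTilde) (g : PSL(2, ℝ)) : Prop :=
  ∀ x : ℝ, linePt (α x) = g • linePt x

lemma IsLift.one : IsLift 1 1 := fun x => by
  simp

lemma IsLift.mul {α β : HomeoTilde} {g h : PSL(2, ℝ)} (ha : IsLift α g) (hb : IsLift β h) :
    IsLift (α * β) (g * h) := fun x => by
  have : (α * β : HomeoTilde) x = α (β x) := rfl
  rw [this, ha, hb, mul_smul]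

lemma IsLift.inv {α : HomeoTilde} {g : PSL(2, ℝ)} (ha : IsLift α g) :
    IsLift α⁻¹ g⁻¹ := fun x => by
  rw [eq_inv_smul_iff, ← ha, CircleDeg1Lift.units_apply_inv_apply]

lemma IsLift.trans_int (k : ℤ) : IsLift (trans k) 1 := fun x => by
  rw [one_smul, linePt_eq_iff]
  exact ⟨k, by simp [trans, add_comm]⟩

/-- The element of `PSL(2, ℝ)` that `α` lifts is unique. -/
lemma IsLift.unique {α : HomeoTilde} {g h : PSL(2, ℝ)} (hg : IsLift α g) (hh : IsLift α h) :
    g = h := by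
  refine eq_of_smul_eq_smul (α := RP1) fun p => ?_
  obtain ⟨x, rfl⟩ := linePt_surjective p
  rw [← hg, ← hh]

/-- The group `SL₂(ℝ)~` of all lifts of elements of `PSL(2, ℝ)`. -/
def SLTilde : Subgroup HomeoTilde where
  carrier := {α | ∃ g : PSL(2, ℝ), IsLift α g}
  one_mem' := ⟨1, IsLift.one⟩
  mul_mem' := fun ⟨g, hg⟩ ⟨h, hh⟩ => ⟨g * h, hg.mul hh⟩
  inv_mem' := fun ⟨g, hg⟩ => ⟨g⁻¹, hg.inv⟩

/-- The image `ᾱ` in `PSL(2, ℝ)` of an element `α` of `SLTilde`. -/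
def image (α : SLTilde) : PSL(2, ℝ) := α.2.choose

lemma image_spec (α : SLTilde) : IsLift α (image α) := α.2.choose_spec

/-- The trace `|a + d|` on `PSL(2, ℝ)`. -/
def absTrace : PSL(2, ℝ) → ℝ :=
  Quotient.lift (fun M : SL(2, ℝ) => |(M : Matrix (Fin 2) (Fin 2) ℝ).trace|) (by
    intro M N h
    have h' : M⁻¹ * N ∈ Subgroup.center SL(2, ℝ) := QuotientGroup.leftRel_apply.1 h
    obtain ⟨r, hr, e⟩ := Matrix.SpecialLinearGroup.mem_center_iff.1 h'
    have e2 : (N : Matrix (Fin 2) (Fin 2) ℝ) = r • (M : Matrix (Fin 2) (Fin 2) ℝ) := by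
      have : N = M * (M⁻¹ * N) := by group
      rw [this, Matrix.SpecialLinearGroup.coe_mul, ← e]
      ext i j
      simp [mul_comm]
    have hr' : |r| = 1 := by
      have : r ^ 2 = 1 := by simpa using hr
      exact (pow_eq_one_iff_of_nonneg (abs_nonneg r) two_ne_zero).1 (by rw [sq_abs, this])
    show |_| = |_|
    rw [e2, Matrix.trace_smul, smul_eq_mul, abs_mul, hr', one_mul])

/-! ### Canonical lifts -/

lemma exists_lift_of_pos (M : SL(2, ℝ))
    (hM : ∀ s t : ℝ, s ^ 2 + t ^ 2 = 1 →
      0 < s * (M 0 0 * s + M 0 1 * t) + t * (M 1 0 * s + M 1 1 * t)) :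
    ∃ α : HomeoTilde, IsLift α (M : PSL(2, ℝ)) := by
  let c : ℝ → ℝ := fun x => Real.cos (Real.pi * x)
  let s : ℝ → ℝ := fun x => Real.sin (Real.pi * x)
  let p : ℝ → ℝ := fun x => M 0 0 * c x + M 0 1 * s x
  let q : ℝ → ℝ := fun x => M 1 0 * c x + M 1 1 * s x
  let D : ℝ → ℝ := fun x => c x * p x + s x * q x
  let C : ℝ → ℝ := fun x => c x * q x - s x * p x
  have hcs : ∀ x, c x ^ 2 + s x ^ 2 = 1 := fun x => Real.cos_sq_add_sin_sq _
  have hD : ∀ x, 0 < D x := fun x => hM _ _ (hcs x)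
  let F : ℝ → ℝ := fun x => x + Real.arctan (C x / D x) / Real.pi
  have hpi := Real.pi_ne_zero
  have hlift : ∀ x, linePt (F x) = (M : PSL(2, ℝ)) • linePt x := by
    intro x
    rw [Matrix.ProjectiveSpecialLinearGroup.smul_proj_mk]
    unfold linePt
    rw [Projectivization.smul_mk, Projectivization.mk_eq_mk_iff']
    have hF : Real.pi * F x = Real.pi * x + Real.arctan (C x / D x) := by
      simp only [F]; field_simp
    have hr : 0 < √(1 + (C x / D x) ^ 2) := Real.sqrt_pos.2 (by positivity)
    refine ⟨(D x * √(1 + (C x / D x) ^ 2))⁻¹, ?_⟩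
    rw [hF]
    have hd := (hD x).ne'
    have h1 : p x = c x * D x - s x * C x := by
      have := hcs x
      simp only [D, C]
      linear_combination (-p x) * this
    have h2 : q x = s x * D x + c x * C x := by
      have := hcs x
      simp only [D, C]
      linear_combination (-q x) * this
    ext i
    fin_cases i
    · have : (M • ![c x, s x]) 0 = p x := by
        simp [Matrix.SpecialLinearGroup.smul_def, p, Matrix.mulVec, dotProduct, Fin.sum_univ_two]
      show _ * (M • ![c x, s x]) 0 = Real.cos _
      rw [this, Real.cos_add, Real.cos_arctan, Real.sin_arctan, h1]
      show _ = c x * _ - s x * _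
      field_simp
    · have : (M • ![c x, s x]) 1 = q x := by
        simp [Matrix.SpecialLinearGroup.smul_def, q, Matrix.mulVec, dotProduct, Fin.sum_univ_two]
      show _ * (M • ![c x, s x]) 1 = Real.sin _
      rw [this, Real.sin_add, Real.cos_arctan, Real.sin_arctan, h2]
      show _ = s x * _ + c x * _
      field_simp
  have hper : ∀ x, F (x + 1) = F x + 1 := by
    intro x
    have e1 : c (x + 1) = -c x := by simp [c, mul_add, Real.cos_add_pi]
    have e2 : s (x + 1) = -s x := by simp [s, mul_add, Real.sin_add_pi]
    have e3 : C (x + 1) = C x := by simp only [C, p, q, e1, e2]; ring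
    have e4 : D (x + 1) = D x := by simp only [D, p, q, e1, e2]; ring
    simp only [F, e3, e4]; ring
  have hcont : Continuous F := by
    have hc : Continuous c := by fun_prop
    have hs : Continuous s := by fun_prop
    have hp : Continuous p := by fun_prop
    have hq : Continuous q := by fun_prop
    have hC : Continuous C := by fun_prop
    have hD' : Continuous D := by fun_prop
    exact continuous_id.add
      ((Real.continuous_arctan.comp (hC.div hD' fun x => (hD x).ne')).div_const _)
  have hint : ∀ (x : ℝ) (k : ℤ), F (x + k) = F x + k := by
    intro x k
    have e := fun y => (hper y)
    have hp : Function.Periodic (fun y => F y - y) 1 := fun y => by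
      simp only [hper]; ring
    have := hp.int_mul k x
    simp only [mul_one] at this
    linarith
  have hinj : Function.Injective F := by
    intro x y h
    have h1 : (M : PSL(2, ℝ)) • linePt x = (M : PSL(2, ℝ)) • linePt y := by
      rw [← hlift, ← hlift, h]
    obtain ⟨k, rfl⟩ := (linePt_eq_iff _ _).1 (MulAction.injective _ h1)
    rw [hint] at h
    linarith
  obtain ⟨α, hα⟩ := exists_coe_eq_of_injective hcont hinj hper
  exact ⟨α, fun x => by rw [hα, hlift]⟩

/-- The matrix of `u_x`. -/
def uMat (x : ℝ) : SL(2, ℝ) := ⟨!![1, x; 0, 1], by simp [Matrix.det_fin_two]⟩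

/-- The matrix of `a_l`. -/
def aMat (l : ℝ) (hl : 0 < l) : SL(2, ℝ) :=
  ⟨!![l, 0; 0, 1 / l], by simp [Matrix.det_fin_two, hl.ne']⟩

/-- The matrix of `ρ_θ`. -/
def rhoMat (θ : ℝ) : SL(2, ℝ) :=
  ⟨!![Real.cos θ, -Real.sin θ; Real.sin θ, Real.cos θ], by
    have := Real.sin_sq_add_cos_sq θ
    simp [Matrix.det_fin_two]; linarith⟩

/-- The matrix of the lower triangular unipotent element. -/
def lMat (x : ℝ) : SL(2, ℝ) := ⟨!![1, 0; x, 1], by simp [Matrix.det_fin_two]⟩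

lemma sl_mul_apply (M N : SL(2, ℝ)) (i j : Fin 2) :
    (M * N) i j = M i 0 * N 0 j + M i 1 * N 1 j := by
  rw [Matrix.SpecialLinearGroup.coe_mul, Matrix.mul_apply, Fin.sum_univ_two]

lemma uMat_add (x y : ℝ) : uMat (x + y) = uMat x * uMat y := by
  ext i j
  rw [sl_mul_apply]
  fin_cases i <;> fin_cases j <;> simp [uMat, add_comm]

lemma lMat_add (x y : ℝ) : lMat (x + y) = lMat x * lMat y := by
  ext i j
  rw [sl_mul_apply]
  fin_cases i <;> fin_cases j <;> simp [lMat]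

lemma exists_lift_mul {M N : SL(2, ℝ)} (hM : ∃ α : HomeoTilde, IsLift α (M : PSL(2, ℝ)))
    (hN : ∃ α : HomeoTilde, IsLift α (N : PSL(2, ℝ))) :
    ∃ α : HomeoTilde, IsLift α ((M * N : SL(2, ℝ)) : PSL(2, ℝ)) := by
  obtain ⟨α, hα⟩ := hM
  obtain ⟨β, hβ⟩ := hN
  exact ⟨α * β, hα.mul hβ⟩

/-- A property of reals that is additive and holds near `0` holds everywhere. -/
lemma forall_of_add {P : ℝ → Prop} (h0 : ∀ x, |x| ≤ 1 → P x)
    (h1 : ∀ x y, P x → P y → P (x + y)) (x : ℝ) : P x := by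
  obtain ⟨n, hn⟩ := exists_nat_ge |x|
  have key : ∀ m : ℕ, P (m * (x / (n + 1))) := by
    intro m
    induction m with
    | zero => exact h0 _ (by simp)
    | succ m ih =>
      have e : ((m + 1 : ℕ) : ℝ) * (x / (n + 1)) = m * (x / (n + 1)) + x / (n + 1) := by
        push_cast; ring
      rw [e]
      refine h1 _ _ ih (h0 _ ?_)
      rw [abs_div, abs_of_pos (by positivity : (0 : ℝ) < n + 1), div_le_one (by positivity)]
      linarith
  have e : ((n + 1 : ℕ) : ℝ) * (x / (n + 1)) = x := by
    have : (n : ℝ) + 1 ≠ 0 := by positivity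
    push_cast; field_simp
  exact e ▸ key (n + 1)

lemma exists_lift_uMat (x : ℝ) : ∃ α : HomeoTilde, IsLift α (uMat x : PSL(2, ℝ)) := by
  refine forall_of_add (P := fun x => ∃ α : HomeoTilde, IsLift α (uMat x : PSL(2, ℝ)))
    (fun x hx => exists_lift_of_pos _ fun s t h => ?_)
    (fun x y hx hy => by rw [uMat_add]; exact exists_lift_mul hx hy) x
  have := abs_le.1 hx
  simp [uMat]
  nlinarith [sq_nonneg (s + t), sq_nonneg (s - t)]

lemma exists_lift_lMat (x : ℝ) : ∃ α : HomeoTilde, IsLift α (lMat x : PSL(2, ℝ)) := by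
  refine forall_of_add (P := fun x => ∃ α : HomeoTilde, IsLift α (lMat x : PSL(2, ℝ)))
    (fun x hx => exists_lift_of_pos _ fun s t h => ?_)
    (fun x y hx hy => by rw [lMat_add]; exact exists_lift_mul hx hy) x
  have := abs_le.1 hx
  simp [lMat]
  nlinarith [sq_nonneg (s + t), sq_nonneg (s - t)]

lemma exists_lift_of_ne (M : SL(2, ℝ)) (h : M 1 0 ≠ 0) :
    ∃ α : HomeoTilde, IsLift α (M : PSL(2, ℝ)) := by
  have hd : M 0 0 * M 1 1 - M 0 1 * M 1 0 = 1 := by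
    have := M.2
    rwa [Matrix.det_fin_two] at this
  have e : M = uMat ((M 0 0 - 1) / M 1 0) * lMat (M 1 0) * uMat ((M 1 1 - 1) / M 1 0) := by
    ext i j
    rw [sl_mul_apply, sl_mul_apply, sl_mul_apply]
    fin_cases i <;> fin_cases j
    · simp [uMat, lMat]; field_simp; ring
    · simp [uMat, lMat]; field_simp; linarith
    · simp [uMat, lMat]
    · simp [uMat, lMat]; field_simp; ring
  rw [e]
  exact exists_lift_mul (exists_lift_mul (exists_lift_uMat _) (exists_lift_lMat _))
    (exists_lift_uMat _)

/-- Every element of `PSL(2, ℝ)` has a lift. -/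
lemma exists_lift (g : PSL(2, ℝ)) : ∃ α : HomeoTilde, IsLift α g := by
  induction g using QuotientGroup.induction_on with | _ M =>
  by_cases h : M 1 0 = 0
  · have e : M = lMat (-1) * (lMat 1 * M) := by
      rw [← mul_assoc, ← lMat_add]
      ext i j
      rw [sl_mul_apply]
      fin_cases i <;> fin_cases j <;> simp [lMat]
    rw [e]
    refine exists_lift_mul (exists_lift_lMat _) (exists_lift_of_ne _ ?_)
    have hd := M.2
    rw [Matrix.det_fin_two] at hd
    intro h0
    rw [sl_mul_apply] at h0
    simp [lMat, h] at h0
    simp [h0, h] at hd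
  · exact exists_lift_of_ne M h

/-- `α` is the canonical lift of `g`: the lift with `α 0 ∈ [0, 1)`. -/
def IsCanonicalLift (g : PSL(2, ℝ)) (α : SLTilde) : Prop :=
  IsLift α g ∧ (α : HomeoTilde) 0 ∈ Set.Ico (0 : ℝ) 1

lemma existsUnique_canonicalLift (g : PSL(2, ℝ)) : ∃! α : SLTilde, IsCanonicalLift g α := by
  obtain ⟨α, hα⟩ := exists_lift g
  have h1 : IsLift (trans ((-⌊α 0⌋ : ℤ) : ℝ) * α) g := by
    have := (IsLift.trans_int (-⌊α 0⌋)).mul hα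
    rwa [one_mul] at this
  refine ⟨⟨_, g, h1⟩, ⟨h1, ?_⟩, ?_⟩
  · have e : (trans ((-⌊α 0⌋ : ℤ) : ℝ) * α : HomeoTilde) 0 = Int.fract (α 0) := by
      show ((-⌊α 0⌋ : ℤ) : ℝ) + α 0 = _
      rw [Int.fract]; push_cast; ring
    show (trans ((-⌊α 0⌋ : ℤ) : ℝ) * α : HomeoTilde) 0 ∈ _
    rw [e]
    exact ⟨Int.fract_nonneg _, Int.fract_lt_one _⟩
  · have key : ∀ β γ : SLTilde, IsCanonicalLift g β → IsCanonicalLift g γ → β = γ := by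
      intro β γ hβ hγ
      have hk : ∀ x, ∃ k : ℤ, (β : HomeoTilde) x = (γ : HomeoTilde) x + k := fun x => by
        rw [← linePt_eq_iff, hβ.1, hγ.1]
      have lt : ∀ k : ℤ, |(k : ℝ)| < 1 → k = 0 := fun k hk => by
        rw [← Int.cast_abs] at hk
        exact Int.abs_lt_one_iff.1 (by exact_mod_cast hk)
      have h0 : (β : HomeoTilde) 0 = (γ : HomeoTilde) 0 := by
        obtain ⟨k, hk⟩ := hk 0
        obtain ⟨b1, b2⟩ := hβ.2
        obtain ⟨c1, c2⟩ := hγ.2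
        have : k = 0 := lt k (abs_lt.2 ⟨by linarith, by linarith⟩)
        simpa [this] using hk
      have hfr : ∀ x ∈ Set.Ico (0 : ℝ) 1, (β : HomeoTilde) x = (γ : HomeoTilde) x := by
        intro x hx
        have hb : ∀ δ : SLTilde, (δ : HomeoTilde) 0 ≤ (δ : HomeoTilde) x ∧
            (δ : HomeoTilde) x < (δ : HomeoTilde) 0 + 1 := by
          intro δ
          have hm : StrictMono (δ : HomeoTilde) :=
            (CircleDeg1Lift.toOrderIso (δ : HomeoTilde)).strictMono
          refine ⟨hm.monotone hx.1, ?_⟩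
          have := hm hx.2
          rwa [show (1 : ℝ) = 0 + 1 by norm_num, CircleDeg1Lift.map_add_one] at this
        obtain ⟨k, hk⟩ := hk x
        have b := hb β
        have c := hb γ
        have : k = 0 := lt k (abs_lt.2 ⟨by linarith, by linarith⟩)
        simpa [this] using hk
      apply Subtype.ext
      apply Units.ext
      ext x
      have e1 := CircleDeg1Lift.map_fract_sub_fract_eq (β : HomeoTilde) x
      have e2 := CircleDeg1Lift.map_fract_sub_fract_eq (γ : HomeoTilde) x
      have e3 := hfr (Int.fract x) ⟨Int.fract_nonneg x, Int.fract_lt_one x⟩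
      linarith
    exact fun γ hγ => key _ _ hγ ⟨h1, by
      have e : (trans ((-⌊α 0⌋ : ℤ) : ℝ) * α : HomeoTilde) 0 = Int.fract (α 0) := by
        show ((-⌊α 0⌋ : ℤ) : ℝ) + α 0 = _
        rw [Int.fract]; push_cast; ring
      show (trans ((-⌊α 0⌋ : ℤ) : ℝ) * α : HomeoTilde) 0 ∈ _
      rw [e]
      exact ⟨Int.fract_nonneg _, Int.fract_lt_one _⟩⟩

/-- The canonical lift of an element of `PSL(2, ℝ)`. -/
def canonicalLift (g : PSL(2, ℝ)) : SLTilde := (existsUnique_canonicalLift g).choose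

lemma canonicalLift_spec (g : PSL(2, ℝ)) : IsCanonicalLift g (canonicalLift g) :=
  (existsUnique_canonicalLift g).choose_spec.1

/-! ### The listed representatives -/

/-- The translation `T_k` by an integer, as an element of `SLTilde`. -/
def T (k : ℤ) : SLTilde := ⟨trans k, 1, IsLift.trans_int k⟩

/-- The canonical lift of `u_x`. -/
def uTilde (x : ℝ) : SLTilde := canonicalLift (uMat x)

/-- The canonical lift of `a_l`, for `l > 1`. -/
def aTilde (l : Set.Ioi (1 : ℝ)) : SLTilde := canonicalLift (aMat l (zero_lt_one.trans l.2))

/-- The canonical lift of `ρ_θ`, for `0 < θ < π`. -/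
def rhoTilde (θ : Set.Ioo (0 : ℝ) Real.pi) : SLTilde := canonicalLift (rhoMat θ)

/-- The angle `π - θ`. -/
def mirror (θ : Set.Ioo (0 : ℝ) Real.pi) : Set.Ioo (0 : ℝ) Real.pi :=
  ⟨Real.pi - θ, by have := θ.2; constructor <;> linarith [this.1, this.2]⟩

/-- Labels for the listed classes `[T_k]`, `[T_k u_1]`, `[T_k u_{-1}]`, `[T_k a_l]`, `[T_k ρ_θ]`
(tildes omitted); `[id]` is `[T_0]`. -/
inductive ClassLabel : Type
  | central (k : ℤ)
  | uPlus (k : ℤ)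
  | uMinus (k : ℤ)
  | hyperbolic (k : ℤ) (l : Set.Ioi (1 : ℝ))
  | elliptic (k : ℤ) (θ : Set.Ioo (0 : ℝ) Real.pi)

/-- The element of `SLTilde` that represents a listed class. -/
def ClassLabel.rep : ClassLabel → SLTilde
  | central k => T k
  | uPlus k => T k * uTilde 1
  | uMinus k => T k * uTilde (-1)
  | hyperbolic k l => T k * aTilde l
  | elliptic k θ => T k * rhoTilde θ

/-- Every element of the conjugacy class of `α` in `SLTilde` has length-sharp `s`. -/
def ClassHasLengthSharp (α : SLTilde) (s : RSharp) : Prop :=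
  ∀ β : SLTilde, IsConj α β → lengthSharp β = s

/-- `α` and `β` agree in trace, direction type and length-sharp. -/
def SameInvariants (α β : SLTilde) : Prop :=
  absTrace (image α) = absTrace (image β) ∧ directionType α = directionType β ∧
    lengthSharp α = lengthSharp β

end

end SL2Cover

open SL2Cover

namespace SL2Cover

/-! ### Homeomorphisms of degree one -/

/-! Exhaustiveness comes from `PSL(2, ℝ)`. Every matrix class is conjugate to the identity, to `u_1`
or `u_{-1}`, to a diagonal `a_l`, or to a rotation (`hasNormalForm`). Such a conjugation lifts, and
two lifts of the same element differ by a central `T_k` (`exists_isConj_T_mul`).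

The invariants are read off from the displacements `α x - x`. A conjugator is increasing and
commutes with integer translations, so it preserves every comparison of `α x` with `x + k`, `k` an
integer, although it distorts the displacements themselves. These comparisons form the profile of a
label (`ClassLabel.Profile.conj`), and the profile determines both `ℓ♯` and the direction type. On
the representatives the profile follows from the sign of `sin (π (α x - x))`, a cross product of a
vector with its image (`canonicalLift_upper_sin`). With this orientation `u_1` moves points backward
and `u_{-1}` forward, whence the asymmetry in the table of lengths.

A case check (`ClassLabel.eq_or_mirror_of_invariants`) then shows that trace, direction type and
`ℓ♯` determine a non-central label up to `θ ↦ π - θ`. That ambiguity is real for the three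
invariants, since `|cos θ|` does not see it, but the translation number `k + θ / π` removes it.
Hence distinct labels give distinct classes. -/

lemma mul_coe_apply (α β : HomeoTilde) (x : ℝ) : (α * β : HomeoTilde) x = α (β x) := rfl

@[simp] lemma trans_apply (u x : ℝ) : trans u x = u + x := rfl

lemma HomeoTilde.continuous (α : HomeoTilde) : Continuous α :=
  (CircleDeg1Lift.toOrderIso α).continuous

lemma HomeoTilde.strictMono (α : HomeoTilde) : StrictMono α :=
  (CircleDeg1Lift.toOrderIso α).strictMono

lemma HomeoTilde.ext {α β : HomeoTilde} (h : ∀ x, α x = β x) : α = β :=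
  Units.ext (CircleDeg1Lift.ext h)

/-- The displacement has period one, so estimates on `[0, 1)` hold on the whole line. -/
lemma HomeoTilde.sub_fract (α : HomeoTilde) (x : ℝ) :
    α x - x = α (Int.fract x) - Int.fract x := by
  have := CircleDeg1Lift.map_fract_sub_fract_eq (α : CircleDeg1Lift) x
  linarith

lemma trans_int_mul_comm (k : ℤ) (α : HomeoTilde) : trans k * α = α * trans k := by
  refine HomeoTilde.ext fun x => ?_
  simp only [mul_coe_apply, trans_apply]
  rw [add_comm (k : ℝ) x, (α : CircleDeg1Lift).map_add_int, add_comm]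

lemma T_mul_comm (k : ℤ) (α : SLTilde) : T k * α = α * T k :=
  Subtype.ext (trans_int_mul_comm k α)

/-- A conjugate of `α` moves `γ y` to `γ (α y)`, and `γ` commutes with integer translations. -/
lemma conj_apply_eq (γ α : HomeoTilde) (k : ℤ) (y : ℝ) :
    (γ * α * γ⁻¹ : HomeoTilde) (γ y) = γ (α y) ∧ γ (y + k) = γ y + k := by
  refine ⟨?_, (γ : CircleDeg1Lift).map_add_int y k⟩
  simp only [mul_coe_apply]
  rw [CircleDeg1Lift.units_inv_apply_apply]

lemma conj_lt_iff (γ α : HomeoTilde) (k : ℤ) (y : ℝ) :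
    (γ * α * γ⁻¹ : HomeoTilde) (γ y) < γ y + k ↔ α y < y + k := by
  obtain ⟨h1, h2⟩ := conj_apply_eq γ α k y
  rw [h1, ← h2, γ.strictMono.lt_iff_lt]

lemma lt_conj_iff (γ α : HomeoTilde) (k : ℤ) (y : ℝ) :
    γ y + k < (γ * α * γ⁻¹ : HomeoTilde) (γ y) ↔ y + k < α y := by
  obtain ⟨h1, h2⟩ := conj_apply_eq γ α k y
  rw [h1, ← h2, γ.strictMono.lt_iff_lt]

lemma HomeoTilde.surjective (γ : HomeoTilde) : Function.Surjective γ :=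
  fun x => ⟨(γ⁻¹ : HomeoTilde) x, CircleDeg1Lift.units_apply_inv_apply γ x⟩

/-! ### Translation numbers and directions -/

/-- The translated map fixes `x`. Thus one point moved backward refutes the condition for `σ = 1`,
and one moved forward refutes that for `σ = -1`. -/
lemma tau_trans_mul_eq_zero {α : HomeoTilde} {ε x : ℝ} (h : α x = x - ε) :
    tau (trans ε * α) = 0 := by
  have : ((trans ε * α : HomeoTilde) : CircleDeg1Lift) x = x + (0 : ℤ) := by
    rw [mul_coe_apply, trans_apply, h]; simp
  simpa [tau] using CircleDeg1Lift.translationNumber_of_eq_add_int _ this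

lemma tau_eq_zero {α : HomeoTilde} {x : ℝ} (h : α x = x) : tau α = 0 := by
  have : (α : CircleDeg1Lift) x = x + (0 : ℤ) := by simpa using h
  simpa [tau] using CircleDeg1Lift.translationNumber_of_eq_add_int _ this

/-- Strictness survives the limit because a continuous periodic positive displacement is bounded
away from zero. -/
lemma tau_pos {α : HomeoTilde} (h : ∀ x, x < α x) : 0 < tau α :=
  CircleDeg1Lift.lt_translationNumber_of_forall_add_lt _ α.continuous fun x => by
    simpa using h x

lemma tau_neg {α : HomeoTilde} (h : ∀ x, α x < x) : tau α < 0 :=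
  CircleDeg1Lift.translationNumber_lt_of_forall_lt_add _ α.continuous fun x => by
    simpa using h x

lemma directionType_of_forall_gt {α : HomeoTilde} (h : ∀ x, x < α x) :
    directionType α = some (1, 1) := by
  have h1 : α ≠ 1 := by rintro rfl; exact lt_irrefl _ (h 0)
  have h2 := tau_pos h
  have h3 : 0 < |tau α| := abs_pos.2 h2.ne'
  rw [directionType, if_neg h1, sigma, if_pos h3, sign_pos h3, sign_pos h2]

lemma directionType_of_forall_lt {α : HomeoTilde} (h : ∀ x, α x < x) :
    directionType α = some (1, -1) := by
  have h1 : α ≠ 1 := by rintro rfl; exact lt_irrefl _ (h 0)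
  have h2 := tau_neg h
  have h3 : 0 < |tau α| := abs_pos.2 h2.ne
  rw [directionType, if_neg h1, sigma, if_pos h3, sign_pos h3, sign_neg h2]

lemma not_forall_tau_pos {α : HomeoTilde} {x : ℝ} (h : α x < x) :
    ¬ ∀ ε : ℝ, 0 < ε → 0 < tau (trans ε * α) := fun H => by
  have := H (x - α x) (by linarith)
  rw [tau_trans_mul_eq_zero (x := x) (by ring)] at this
  exact lt_irrefl _ this

lemma not_forall_tau_neg {α : HomeoTilde} {x : ℝ} (h : x < α x) :
    ¬ ∀ ε : ℝ, 0 < ε → tau (trans (-ε) * α) < 0 := fun H => by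
  have := H (α x - x) (by linarith)
  rw [tau_trans_mul_eq_zero (x := x) (by ring)] at this
  exact lt_irrefl _ this

lemma directionType_semiForward {α : HomeoTilde} (h : ∀ x, x ≤ α x) (h0 : ∃ x, α x = x)
    (h1 : ∃ x, x < α x) : directionType α = some (0, 1) := by
  obtain ⟨y, hy⟩ := h1
  have hne : α ≠ 1 := by rintro rfl; exact lt_irrefl _ hy
  have ht : tau α = 0 := tau_eq_zero h0.choose_spec
  have hp : ∀ ε : ℝ, 0 < ε → 0 < tau (trans ε * α) := fun ε hε => by
    refine tau_pos fun x => ?_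
    rw [mul_coe_apply, trans_apply]
    linarith [h x]
  rw [directionType, if_neg hne, sigma, if_neg (by simp [ht]), if_pos ⟨hne, ht, hp⟩]
  simp [ht]

lemma directionType_semiBackward {α : HomeoTilde} (h : ∀ x, α x ≤ x) (h0 : ∃ x, α x = x)
    (h1 : ∃ x, α x < x) : directionType α = some (0, -1) := by
  obtain ⟨y, hy⟩ := h1
  have hne : α ≠ 1 := by rintro rfl; exact lt_irrefl _ hy
  have ht : tau α = 0 := tau_eq_zero h0.choose_spec
  have hp : ∀ ε : ℝ, 0 < ε → tau (trans (-ε) * α) < 0 := fun ε hε => by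
    refine tau_neg fun x => ?_
    rw [mul_coe_apply, trans_apply]
    linarith [h x]
  -- `sigma` tests the value `1` first, so a point moved backward is needed to rule that case out.
  rw [directionType, if_neg hne, sigma, if_neg (by simp [ht]),
    if_neg (fun H => not_forall_tau_pos hy H.2.2), if_pos ⟨hne, ht, hp⟩]
  simp [ht]

/-- The intermediate value theorem gives a fixed point, so `tau α = 0`; the two given points refute
both one-sided conditions. -/
lemma directionType_alternating {α : HomeoTilde} (h0 : ∃ x, α x < x) (h1 : ∃ x, x < α x) :
    directionType α = some (0, 0) := by
  obtain ⟨y, hy⟩ := h0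
  obtain ⟨z, hz⟩ := h1
  have hne : α ≠ 1 := by rintro rfl; exact lt_irrefl _ hy
  obtain ⟨x, hx⟩ : ∃ x, α x - x = 0 :=
    mem_range_of_exists_le_of_exists_ge (f := fun x => α x - x) (α.continuous.sub continuous_id)
      ⟨y, by linarith⟩ ⟨z, by linarith⟩
  have ht : tau α = 0 := tau_eq_zero (sub_eq_zero.1 hx)
  rw [directionType, if_neg hne, sigma, if_neg (by simp [ht]),
    if_neg (fun H => not_forall_tau_pos hy H.2.2), if_neg (fun H => not_forall_tau_neg hz H.2.2)]
  simp [ht]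

/-! ### Displacement lengths -/

lemma sharp_eq_sharpIoo {x : ℝ} {n : ℤ} (h1 : (n : ℝ) < x) (h2 : x < n + 1) :
    sharp x = sharpIoo n :=
  Quotient.sound (Or.inr ⟨n, ⟨h1, h2⟩, by constructor <;> linarith⟩)

lemma sharpInt_injective : Function.Injective sharpInt := fun m n h => by
  rcases Quotient.exact h with ⟨h, -⟩ | ⟨k, h1, -⟩
  · exact_mod_cast h
  · have a : k < m := by exact_mod_cast h1.1
    have b : m < k + 1 := by exact_mod_cast h1.2
    omega

lemma sharpIoo_injective : Function.Injective sharpIoo := fun m n h => by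
  rcases Quotient.exact h with ⟨h, -⟩ | ⟨k, h1, h2⟩
  · exact_mod_cast add_right_cancel h
  · have key : ∀ i : ℤ, (i : ℝ) + 1 / 2 ∈ Set.Ioo (k : ℝ) (k + 1) → i = k := fun i hi => by
      have a : k < i + 1 := by exact_mod_cast (by linarith [hi.1] : (k : ℝ) < i + 1)
      have b : i < k + 1 := by exact_mod_cast (by linarith [hi.2] : (i : ℝ) < k + 1)
      omega
    rw [key m h1, key n h2]

lemma sharpInt_ne_sharpIoo (m n : ℤ) : sharpInt m ≠ sharpIoo n := fun h => by
  rcases Quotient.exact h with ⟨h, -⟩ | ⟨k, h1, -⟩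
  -- An integer is not a half-integer, by parity.
  · have : 2 * m = 2 * n + 1 := by exact_mod_cast (by linarith : (2 : ℝ) * m = 2 * n + 1)
    omega
  · have a : k < m := by exact_mod_cast h1.1
    have b : m < k + 1 := by exact_mod_cast h1.2
    omega

/-- The supremum is attained by compactness, so a strict pointwise bound by an integer remains
strict for `length`. -/
lemma exists_length_eq (α : HomeoTilde) :
    (∃ x, length α = |α x - x|) ∧ ∀ x, |α x - x| ≤ length α := by
  have hc : Continuous fun t : Set.Icc (0 : ℝ) 1 => |α t - t| :=
    ((α.continuous.comp continuous_subtype_val).sub continuous_subtype_val).abs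
  have hb : BddAbove (Set.range fun t : Set.Icc (0 : ℝ) 1 => |α t - t|) :=
    (isCompact_range hc).bddAbove
  constructor
  · obtain ⟨t, -, ht⟩ := isCompact_univ.exists_isMaxOn Set.univ_nonempty hc.continuousOn
    exact ⟨t, le_antisymm (ciSup_le fun s => ht (Set.mem_univ s)) (le_ciSup hb t)⟩
  · intro x
    rw [α.sub_fract]
    exact le_ciSup hb ⟨Int.fract x, Int.fract_nonneg x, (Int.fract_lt_one x).le⟩

lemma lengthSharp_eq_sharpInt {α : HomeoTilde} {n : ℤ} (h : ∀ x, |α x - x| ≤ n)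
    (h1 : ∃ x, |α x - x| = n) : lengthSharp α = sharpInt n := by
  obtain ⟨⟨y, hy⟩, hl⟩ := exists_length_eq α
  obtain ⟨x, hx⟩ := h1
  have : length α = n := le_antisymm (hy ▸ h y) (hx ▸ hl x)
  rw [lengthSharp, this, sharpInt]

lemma lengthSharp_eq_sharpIoo {α : HomeoTilde} {n : ℤ} (h : ∀ x, |α x - x| < n + 1)
    (h1 : ∃ x, n < |α x - x|) : lengthSharp α = sharpIoo n := by
  obtain ⟨⟨y, hy⟩, hl⟩ := exists_length_eq α
  obtain ⟨x, hx⟩ := h1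
  exact sharp_eq_sharpIoo (hx.trans_le (hl x)) (hy ▸ h y)

/-! ### Displacement profiles of the listed classes -/

/-- The position of the displacements `α x - x` relative to the integers, for `α` in the class with
the given label. -/
def ClassLabel.Profile : ClassLabel → HomeoTilde → Prop
  | central k, α => ∀ x, α x = x + k
  | uPlus k, α => (∀ x, x + (k - 1 : ℤ) < α x) ∧ (∀ x, α x ≤ x + k) ∧
      (∃ x, α x = x + k) ∧ ∃ x, α x < x + k
  | uMinus k, α => (∀ x, α x < x + (k + 1 : ℤ)) ∧ (∀ x, x + k ≤ α x) ∧
      (∃ x, α x = x + k) ∧ ∃ x, x + k < α x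
  | hyperbolic k _, α => (∀ x, x + (k - 1 : ℤ) < α x) ∧ (∀ x, α x < x + (k + 1 : ℤ)) ∧
      (∃ x, α x < x + k) ∧ ∃ x, x + k < α x
  | elliptic k _, α => (∀ x, x + k < α x) ∧ ∀ x, α x < x + (k + 1 : ℤ)

/-- A profile consists only of comparisons of `α x` with `x + m`, `m` an integer; the substitution
`x = γ y` carries each of them over. -/
lemma ClassLabel.Profile.conj {c : ClassLabel} {α : HomeoTilde} (h : c.Profile α)
    (γ : HomeoTilde) : c.Profile (γ * α * γ⁻¹) := by
  have heq : ∀ (k : ℤ) y, (γ * α * γ⁻¹ : HomeoTilde) (γ y) = γ y + k ↔ α y = y + k := by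
    intro k y
    obtain ⟨h1, h2⟩ := conj_apply_eq γ α k y
    rw [h1, ← h2, γ.strictMono.injective.eq_iff]
  have all_lt : ∀ k : ℤ, (∀ x, α x < x + k) → ∀ x, (γ * α * γ⁻¹ : HomeoTilde) x < x + k := by
    intro k H x
    obtain ⟨y, rfl⟩ := γ.surjective x
    exact (conj_lt_iff γ α k y).2 (H y)
  have all_gt : ∀ k : ℤ, (∀ x, x + k < α x) → ∀ x, x + k < (γ * α * γ⁻¹ : HomeoTilde) x := by
    intro k H x
    obtain ⟨y, rfl⟩ := γ.surjective x
    exact (lt_conj_iff γ α k y).2 (H y)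
  have all_le : ∀ k : ℤ, (∀ x, α x ≤ x + k) → ∀ x, (γ * α * γ⁻¹ : HomeoTilde) x ≤ x + k := by
    intro k H x
    obtain ⟨y, rfl⟩ := γ.surjective x
    exact not_lt.1 fun h => not_lt.2 (H y) ((lt_conj_iff γ α k y).1 h)
  have all_ge : ∀ k : ℤ, (∀ x, x + k ≤ α x) → ∀ x, x + k ≤ (γ * α * γ⁻¹ : HomeoTilde) x := by
    intro k H x
    obtain ⟨y, rfl⟩ := γ.surjective x
    exact not_lt.1 fun h => not_lt.2 (H y) ((conj_lt_iff γ α k y).1 h)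
  have ex_eq : ∀ k : ℤ, (∃ x, α x = x + k) → ∃ x, (γ * α * γ⁻¹ : HomeoTilde) x = x + k :=
    fun k ⟨x, hx⟩ => ⟨γ x, (heq k x).2 hx⟩
  have ex_lt : ∀ k : ℤ, (∃ x, α x < x + k) → ∃ x, (γ * α * γ⁻¹ : HomeoTilde) x < x + k :=
    fun k ⟨x, hx⟩ => ⟨γ x, (conj_lt_iff γ α k x).2 hx⟩
  have ex_gt : ∀ k : ℤ, (∃ x, x + k < α x) → ∃ x, x + k < (γ * α * γ⁻¹ : HomeoTilde) x :=
    fun k ⟨x, hx⟩ => ⟨γ x, (lt_conj_iff γ α k x).2 hx⟩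
  cases c with
  | central k =>
    intro x
    obtain ⟨y, rfl⟩ := γ.surjective x
    exact (heq k y).2 (h y)
  | uPlus k => exact ⟨all_gt _ h.1, all_le _ h.2.1, ex_eq _ h.2.2.1, ex_lt _ h.2.2.2⟩
  | uMinus k => exact ⟨all_lt _ h.1, all_ge _ h.2.1, ex_eq _ h.2.2.1, ex_gt _ h.2.2.2⟩
  | hyperbolic k l => exact ⟨all_gt _ h.1, all_lt _ h.2.1, ex_lt _ h.2.2.1, ex_gt _ h.2.2.2⟩
  | elliptic k θ => exact ⟨all_gt _ h.1, all_lt _ h.2⟩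

lemma ClassLabel.Profile.of_isConj {c : ClassLabel} {α β : SLTilde} (h : c.Profile α)
    (hc : IsConj α β) : c.Profile β := by
  obtain ⟨γ, rfl⟩ := isConj_iff.1 hc
  exact h.conj γ

/-- The value of `ℓ♯` on the class with the given label. -/
noncomputable def ClassLabel.lengthClass : ClassLabel → RSharp
  | central k => sharpInt |k|
  | uPlus k => if 1 ≤ k then sharpInt k else sharpIoo (-k)
  | uMinus k => if k ≤ -1 then sharpInt (-k) else sharpIoo k
  | hyperbolic k _ => sharpIoo |k|
  | elliptic k _ => if 0 ≤ k then sharpIoo k else sharpIoo (-1 - k)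

/-- For `uPlus k` the displacements lie in `(k - 1, k]`. If `k ≥ 1`, the largest absolute value is
the attained end `k`; if `k ≤ 0`, it lies strictly between `-k` and `-k + 1`. The case `uMinus` is
the reflection of this. -/
lemma ClassLabel.Profile.lengthSharp_eq {c : ClassLabel} {α : HomeoTilde} (h : c.Profile α) :
    lengthSharp α = c.lengthClass := by
  cases c with
  | central k =>
    have (x : ℝ) : |α x - x| = (|k| : ℤ) := by rw [h x]; simp
    exact lengthSharp_eq_sharpInt (fun x => (this x).le) ⟨0, this 0⟩
  | uPlus k =>
    obtain ⟨h1, h2, ⟨y, hy⟩, z, hz⟩ := h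
    push_cast at h1
    simp only [lengthClass]
    split_ifs with hk
    · have hk' : (1 : ℝ) ≤ k := by exact_mod_cast hk
      refine lengthSharp_eq_sharpInt (fun x => ?_) ⟨y, ?_⟩
      · rw [abs_le]; constructor <;> linarith [h1 x, h2 x]
      · rw [hy, abs_of_nonneg] <;> linarith
    · have hk' : (k : ℝ) ≤ 0 := by exact_mod_cast (by omega : k ≤ 0)
      refine lengthSharp_eq_sharpIoo (fun x => ?_) ⟨z, ?_⟩
      · push_cast; rw [abs_lt]; constructor <;> linarith [h1 x, h2 x]
      · push_cast; rw [lt_abs]; right; linarith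
  | uMinus k =>
    obtain ⟨h1, h2, ⟨y, hy⟩, z, hz⟩ := h
    push_cast at h1
    simp only [lengthClass]
    split_ifs with hk
    · have hk' : (k : ℝ) ≤ -1 := by exact_mod_cast hk
      refine lengthSharp_eq_sharpInt (fun x => ?_) ⟨y, ?_⟩
      · push_cast; rw [abs_le]; constructor <;> linarith [h1 x, h2 x]
      · push_cast; rw [hy, abs_of_nonpos] <;> linarith
    · have hk' : (0 : ℝ) ≤ k := by exact_mod_cast (by omega : 0 ≤ k)
      refine lengthSharp_eq_sharpIoo (fun x => ?_) ⟨z, ?_⟩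
      · rw [abs_lt]; constructor <;> linarith [h1 x, h2 x]
      · rw [lt_abs]; left; linarith
  | hyperbolic k l =>
    obtain ⟨h1, h2, ⟨y, hy⟩, z, hz⟩ := h
    push_cast at h1 h2
    simp only [lengthClass]
    rcases le_total 0 k with hk | hk
    · have hk' : (0 : ℝ) ≤ k := by exact_mod_cast hk
      rw [abs_of_nonneg hk]
      refine lengthSharp_eq_sharpIoo (fun x => ?_) ⟨z, ?_⟩
      · rw [abs_lt]; constructor <;> linarith [h1 x, h2 x]
      · rw [lt_abs]; left; linarith
    · have hk' : (k : ℝ) ≤ 0 := by exact_mod_cast hk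
      rw [abs_of_nonpos hk]
      refine lengthSharp_eq_sharpIoo (fun x => ?_) ⟨y, ?_⟩
      · push_cast; rw [abs_lt]; constructor <;> linarith [h1 x, h2 x]
      · push_cast; rw [lt_abs]; right; linarith
  | elliptic k θ =>
    obtain ⟨h1, h2⟩ := h
    push_cast at h2
    simp only [lengthClass]
    split_ifs with hk
    · have hk' : (0 : ℝ) ≤ k := by exact_mod_cast hk
      refine lengthSharp_eq_sharpIoo (fun x => ?_) ⟨0, ?_⟩
      · rw [abs_lt]; constructor <;> linarith [h1 x, h2 x]
      · rw [lt_abs]; left; linarith [h1 0]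
    · have hk' : (k : ℝ) + 1 ≤ 0 := by exact_mod_cast (by omega : k + 1 ≤ 0)
      refine lengthSharp_eq_sharpIoo (fun x => ?_) ⟨0, ?_⟩
      · push_cast; rw [abs_lt]; constructor <;> linarith [h1 x, h2 x]
      · push_cast; rw [lt_abs]; right; linarith [h2 0]

/-- The direction type of the non-central class with the given label. -/
noncomputable def ClassLabel.direction : ClassLabel → SignType × SignType
  | central k => (SignType.sign |k|, SignType.sign k)
  | uPlus k => if k = 0 then (0, -1) else (1, SignType.sign k)
  | uMinus k => if k = 0 then (0, 1) else (1, SignType.sign k)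
  | hyperbolic k _ => if k = 0 then (0, 0) else (1, SignType.sign k)
  | elliptic k _ => if 0 ≤ k then (1, 1) else (1, -1)

/-- Whether the class with the given label is one of the classes `[T_k]`. -/
def ClassLabel.IsCentral : ClassLabel → Prop
  | central _ => True
  | _ => False

lemma ClassLabel.Profile.directionType_eq {c : ClassLabel} {α : HomeoTilde} (h : c.Profile α)
    (hc : ¬ c.IsCentral) : directionType α = some c.direction := by
  cases c with
  | central k => exact absurd trivial hc
  | uPlus k =>
    obtain ⟨h1, h2, h3, h4⟩ := h
    push_cast at h1
    simp only [direction]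
    rcases lt_trichotomy k 0 with hk | rfl | hk
    · have hk' : (k : ℝ) < 0 := by exact_mod_cast hk
      rw [if_neg hk.ne, sign_neg hk]
      exact directionType_of_forall_lt fun x => by linarith [h2 x]
    · rw [if_pos rfl]
      simp only [Int.cast_zero, add_zero] at h2 h3 h4
      exact directionType_semiBackward h2 h3 h4
    · have hk' : (1 : ℝ) ≤ k := by exact_mod_cast hk
      rw [if_neg hk.ne', sign_pos hk]
      exact directionType_of_forall_gt fun x => by linarith [h1 x]
  | uMinus k =>
    obtain ⟨h1, h2, h3, h4⟩ := h
    push_cast at h1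
    simp only [direction]
    rcases lt_trichotomy k 0 with hk | rfl | hk
    · have hk' : (k : ℝ) + 1 ≤ 0 := by exact_mod_cast hk
      rw [if_neg hk.ne, sign_neg hk]
      exact directionType_of_forall_lt fun x => by linarith [h1 x]
    · rw [if_pos rfl]
      simp only [Int.cast_zero, add_zero] at h2 h3 h4
      exact directionType_semiForward h2 h3 h4
    · have hk' : (0 : ℝ) < k := by exact_mod_cast hk
      rw [if_neg hk.ne', sign_pos hk]
      exact directionType_of_forall_gt fun x => by linarith [h2 x]
  | hyperbolic k l =>
    obtain ⟨h1, h2, h3, h4⟩ := h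
    push_cast at h1 h2
    simp only [direction]
    rcases lt_trichotomy k 0 with hk | rfl | hk
    · have hk' : (k : ℝ) + 1 ≤ 0 := by exact_mod_cast hk
      rw [if_neg hk.ne, sign_neg hk]
      exact directionType_of_forall_lt fun x => by linarith [h2 x]
    · rw [if_pos rfl]
      simp only [Int.cast_zero, add_zero] at h3 h4
      exact directionType_alternating h3 h4
    · have hk' : (1 : ℝ) ≤ k := by exact_mod_cast hk
      rw [if_neg hk.ne', sign_pos hk]
      exact directionType_of_forall_gt fun x => by linarith [h1 x]
  | elliptic k θ =>
    obtain ⟨h1, h2⟩ := h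
    push_cast at h2
    simp only [direction]
    split_ifs with hk
    · have hk' : (0 : ℝ) ≤ k := by exact_mod_cast hk
      exact directionType_of_forall_gt fun x => by linarith [h1 x]
    · have hk' : (k : ℝ) + 1 ≤ 0 := by exact_mod_cast (by omega : k + 1 ≤ 0)
      exact directionType_of_forall_lt fun x => by linarith [h2 x]

/-! ### Lifts -/

lemma T_mul_apply (k : ℤ) (α : SLTilde) (x : ℝ) :
    ((T k * α : SLTilde) : HomeoTilde) x = k + (α : HomeoTilde) x := rfl

lemma T_zero : T 0 = 1 := by
  refine Subtype.ext (HomeoTilde.ext fun x => ?_)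
  show ((0 : ℤ) : ℝ) + x = x
  simp

lemma T_neg_mul_T_mul (k : ℤ) (α : SLTilde) : T k * (T (-k) * α) = α := by
  refine Subtype.ext (HomeoTilde.ext fun x => ?_)
  rw [T_mul_apply, T_mul_apply]
  push_cast
  ring

lemma IsLift.T_mul {α : SLTilde} {g : PSL(2, ℝ)} (h : IsLift α g) (k : ℤ) :
    IsLift (T k * α : SLTilde) g := by
  have := (IsLift.trans_int k).mul h
  rw [one_mul] at this
  exact this

lemma image_eq {α : SLTilde} {g : PSL(2, ℝ)} (h : IsLift α g) : image α = g :=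
  (image_spec α).unique h

lemma eq_canonicalLift {α : SLTilde} {g : PSL(2, ℝ)} (h : IsCanonicalLift g α) :
    α = canonicalLift g :=
  (existsUnique_canonicalLift g).unique h (canonicalLift_spec g)

/-- Translating by `-⌊α 0⌋` brings the value at `0` into `[0, 1)`, which singles out the canonical
lift. -/
lemma eq_T_mul_canonicalLift {α : SLTilde} {g : PSL(2, ℝ)} (h : IsLift α g) :
    ∃ k : ℤ, α = T k * canonicalLift g := by
  refine ⟨⌊(α : HomeoTilde) 0⌋, ?_⟩
  rw [← eq_canonicalLift (α := T (-⌊(α : HomeoTilde) 0⌋) * α) ⟨h.T_mul _, ?_⟩, T_neg_mul_T_mul]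
  rw [T_mul_apply]
  have e : ((-⌊(α : HomeoTilde) 0⌋ : ℤ) : ℝ) + (α : HomeoTilde) 0 =
      Int.fract ((α : HomeoTilde) 0) := by
    rw [Int.fract]; push_cast; ring
  rw [e]
  exact ⟨Int.fract_nonneg _, Int.fract_lt_one _⟩

lemma canonicalLift_one : canonicalLift 1 = 1 := by
  have h : IsCanonicalLift 1 1 := by
    refine ⟨IsLift.one, ?_⟩
    change (0 : ℝ) ∈ Set.Ico (0 : ℝ) 1
    norm_num
  exact (eq_canonicalLift h).symm

/-- Conjugating by any lift of the conjugator yields a lift of `g`, which is canonical up to an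
integer translation. -/
lemma exists_isConj_T_mul {α : SLTilde} {g : PSL(2, ℝ)} (h : IsConj (image α) g) :
    ∃ k : ℤ, IsConj α (T k * canonicalLift g) := by
  obtain ⟨c, hc⟩ := isConj_iff.1 h
  have hl : IsLift (canonicalLift c * α * (canonicalLift c)⁻¹ : SLTilde) g := by
    rw [← hc]
    exact ((canonicalLift_spec c).1.mul (image_spec α)).mul (canonicalLift_spec c).1.inv
  obtain ⟨k, hk⟩ := eq_T_mul_canonicalLift hl
  exact ⟨k, isConj_iff.2 ⟨_, hk⟩⟩

lemma isConj_image {α β : SLTilde} (h : IsConj α β) : IsConj (image α) (image β) := by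
  obtain ⟨c, rfl⟩ := isConj_iff.1 h
  refine isConj_iff.2 ⟨image c, (image_eq ?_).symm⟩
  exact ((image_spec c).mul (image_spec α)).mul (image_spec c).inv

lemma absTrace_coe (M : SL(2, ℝ)) :
    absTrace (M : PSL(2, ℝ)) = |(M : Matrix (Fin 2) (Fin 2) ℝ).trace| := rfl

lemma absTrace_eq_of_isConj {g h : PSL(2, ℝ)} (hc : IsConj g h) : absTrace g = absTrace h := by
  obtain ⟨c, rfl⟩ := isConj_iff.1 hc
  induction g using QuotientGroup.induction_on with | _ M =>
  induction c using QuotientGroup.induction_on with | _ N =>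
  rw [← QuotientGroup.mk_inv, ← QuotientGroup.mk_mul, ← QuotientGroup.mk_mul, absTrace_coe,
    absTrace_coe, Matrix.SpecialLinearGroup.coe_mul, Matrix.trace_mul_comm,
    ← Matrix.SpecialLinearGroup.coe_mul]
  rw [← mul_assoc, inv_mul_cancel, one_mul]

/-- A projective point fixes its direction vector only up to scale, so the sign of `r` is not
controlled here. -/
lemma IsLift.exists_smul {α : HomeoTilde} {M : SL(2, ℝ)} (h : IsLift α (M : PSL(2, ℝ))) (x : ℝ) :
    ∃ r : ℝ, r * Real.cos (Real.pi * α x) =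
        M 0 0 * Real.cos (Real.pi * x) + M 0 1 * Real.sin (Real.pi * x) ∧
      r * Real.sin (Real.pi * α x) =
        M 1 0 * Real.cos (Real.pi * x) + M 1 1 * Real.sin (Real.pi * x) := by
  have hx := h x
  rw [Matrix.ProjectiveSpecialLinearGroup.smul_proj_mk] at hx
  unfold linePt at hx
  rw [Projectivization.smul_mk, eq_comm, Projectivization.mk_eq_mk_iff'] at hx
  obtain ⟨r, hr⟩ := hx
  refine ⟨r, ?_, ?_⟩
  · have := congrFun hr 0
    simpa [Matrix.SpecialLinearGroup.smul_def, Matrix.mulVec, dotProduct, Fin.sum_univ_two]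
      using this
  · have := congrFun hr 1
    simpa [Matrix.SpecialLinearGroup.smul_def, Matrix.mulVec, dotProduct, Fin.sum_univ_two]
      using this

/-! ### Lifts of upper triangular matrices -/

section Upper

variable {M : SL(2, ℝ)}

/-- The horizontal line is invariant, so the value at `0` is an integer, and it lies in `[0, 1)`. -/
lemma canonicalLift_upper_zero (h10 : M 1 0 = 0) :
    (canonicalLift (M : PSL(2, ℝ)) : HomeoTilde) 0 = 0 := by
  obtain ⟨hl, h0, h1⟩ := canonicalLift_spec (M : PSL(2, ℝ))
  have hd : M 0 0 * M 1 1 = 1 := by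
    have := M.2
    rw [Matrix.det_fin_two] at this
    simpa [h10] using this
  obtain ⟨r, hr0, hr1⟩ := hl.exists_smul 0
  simp only [mul_zero, Real.cos_zero, Real.sin_zero, h10, mul_one, add_zero] at hr0 hr1
  rcases mul_eq_zero.1 hr1 with hr | hr
  · rw [hr, zero_mul] at hr0
    rw [← hr0, zero_mul] at hd
    exact absurd hd zero_ne_one
  · by_contra hne
    have hpos := lt_of_le_of_ne h0 (Ne.symm hne)
    have := Real.pi_pos
    exact (Real.sin_pos_of_pos_of_lt_pi (by positivity) (by nlinarith)).ne' hr

lemma canonicalLift_upper_mem (h10 : M 1 0 = 0) {x : ℝ} (hx : x ∈ Set.Ioo (0 : ℝ) 1) :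
    (canonicalLift (M : PSL(2, ℝ)) : HomeoTilde) x ∈ Set.Ioo (0 : ℝ) 1 := by
  have h0 := canonicalLift_upper_zero h10
  set α : HomeoTilde := (canonicalLift (M : PSL(2, ℝ)) : HomeoTilde)
  have h1 : α 1 = 1 := by
    have := (α : CircleDeg1Lift).map_add_one 0
    simpa [h0] using this
  exact ⟨h0 ▸ α.strictMono hx.1, by simpa [h1] using α.strictMono hx.2⟩

lemma canonicalLift_upper_abs_lt (h10 : M 1 0 = 0) (x : ℝ) :
    |(canonicalLift (M : PSL(2, ℝ)) : HomeoTilde) x - x| < 1 := by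
  rw [HomeoTilde.sub_fract]
  rcases (Int.fract_nonneg x).eq_or_lt with h | h
  · rw [← h, canonicalLift_upper_zero h10]; simp
  · obtain ⟨h1, h2⟩ := canonicalLift_upper_mem h10 ⟨h, Int.fract_lt_one x⟩
    rw [abs_lt]
    constructor <;> linarith [Int.fract_lt_one x]

/-- Let `v = (cos πx, sin πx)`. The cross product of `v` and `M v` is `r sin (π (α x - x))`, with
`r` the scale factor of `IsLift.exists_smul`. For upper triangular `M` it also equals `sin πx` times
the bracket on the right. -/
lemma canonicalLift_upper_sin (h10 : M 1 0 = 0) (h11 : 0 < M 1 1) {x : ℝ}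
    (hx : x ∈ Set.Ioo (0 : ℝ) 1) : ∃ r : ℝ, 0 < r ∧
      Real.sin (Real.pi * ((canonicalLift (M : PSL(2, ℝ)) : HomeoTilde) x - x)) =
        r * ((M 1 1 - M 0 0) * Real.cos (Real.pi * x) - M 0 1 * Real.sin (Real.pi * x)) := by
  have hpi := Real.pi_pos
  obtain ⟨hα0, hα1⟩ := canonicalLift_upper_mem h10 hx
  obtain ⟨r, hr0, hr1⟩ := (canonicalLift_spec (M : PSL(2, ℝ))).1.exists_smul x
  set α : HomeoTilde := (canonicalLift (M : PSL(2, ℝ)) : HomeoTilde)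
  have hs : 0 < Real.sin (Real.pi * x) :=
    Real.sin_pos_of_pos_of_lt_pi (mul_pos hpi hx.1) (by nlinarith [hx.2])
  have hsα : 0 < Real.sin (Real.pi * α x) :=
    Real.sin_pos_of_pos_of_lt_pi (mul_pos hpi hα0) (by nlinarith)
  rw [h10, zero_mul, zero_add] at hr1
  -- Both `x` and `α x` lie in `(0, 1)`, so the two sines are positive and `r` inherits the sign of
  -- `M 1 1`.
  have hr : 0 < r := pos_of_mul_pos_left (hr1 ▸ mul_pos h11 hs) hsα.le
  refine ⟨Real.sin (Real.pi * x) / r, div_pos hs hr, ?_⟩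
  rw [mul_sub, Real.sin_sub]
  field_simp
  linear_combination Real.cos (Real.pi * x) * hr1 - Real.sin (Real.pi * x) * hr0

/-- The displacement is less than one in absolute value, so it has the sign of its sine. -/
lemma canonicalLift_upper_lt (h10 : M 1 0 = 0) (h11 : 0 < M 1 1) {x : ℝ}
    (hx : x ∈ Set.Ioo (0 : ℝ) 1)
    (h : (M 1 1 - M 0 0) * Real.cos (Real.pi * x) - M 0 1 * Real.sin (Real.pi * x) < 0) :
    (canonicalLift (M : PSL(2, ℝ)) : HomeoTilde) x < x := by
  obtain ⟨r, hr, e⟩ := canonicalLift_upper_sin h10 h11 hx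
  have hlt := abs_lt.1 (canonicalLift_upper_abs_lt h10 x)
  by_contra! hle
  have hpi := Real.pi_pos
  have := Real.sin_nonneg_of_nonneg_of_le_pi (mul_nonneg hpi.le (sub_nonneg.2 hle))
    (by nlinarith [hlt.2])
  rw [e] at this
  exact absurd this (not_le.2 (mul_neg_of_pos_of_neg hr h))

lemma lt_canonicalLift_upper (h10 : M 1 0 = 0) (h11 : 0 < M 1 1) {x : ℝ}
    (hx : x ∈ Set.Ioo (0 : ℝ) 1)
    (h : 0 < (M 1 1 - M 0 0) * Real.cos (Real.pi * x) - M 0 1 * Real.sin (Real.pi * x)) :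
    x < (canonicalLift (M : PSL(2, ℝ)) : HomeoTilde) x := by
  obtain ⟨r, hr, e⟩ := canonicalLift_upper_sin h10 h11 hx
  have hlt := abs_lt.1 (canonicalLift_upper_abs_lt h10 x)
  by_contra! hle
  have hpi := Real.pi_pos
  have := Real.sin_nonpos_of_nonpos_of_neg_pi_le
    (mul_nonpos_of_nonneg_of_nonpos hpi.le (sub_nonpos.2 hle)) (by nlinarith [hlt.1])
  rw [e] at this
  exact absurd this (not_le.2 (mul_pos hr h))

end Upper

/-! ### Lifts of the unipotent, diagonal and rotation matrices -/

lemma uTilde_lt {x y : ℝ} (hx : x ∈ Set.Ioo (0 : ℝ) 1) (hy : 0 < y) :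
    (uTilde y : HomeoTilde) x < x := by
  refine canonicalLift_upper_lt (by simp [uMat]) (by simp [uMat]) hx ?_
  have hs : 0 < Real.sin (Real.pi * x) :=
    Real.sin_pos_of_pos_of_lt_pi (mul_pos Real.pi_pos hx.1) (by nlinarith [hx.2, Real.pi_pos])
  simp [uMat, hs, hy]

lemma lt_uTilde {x y : ℝ} (hx : x ∈ Set.Ioo (0 : ℝ) 1) (hy : y < 0) :
    x < (uTilde y : HomeoTilde) x := by
  refine lt_canonicalLift_upper (by simp [uMat]) (by simp [uMat]) hx ?_
  have hs : 0 < Real.sin (Real.pi * x) :=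
    Real.sin_pos_of_pos_of_lt_pi (mul_pos Real.pi_pos hx.1) (by nlinarith [hx.2, Real.pi_pos])
  simpa [uMat] using mul_neg_of_neg_of_pos hy hs

lemma uTilde_zero (y : ℝ) : (uTilde y : HomeoTilde) 0 = 0 :=
  canonicalLift_upper_zero (by simp [uMat])

lemma uTilde_le {y : ℝ} (hy : 0 < y) (x : ℝ) : (uTilde y : HomeoTilde) x ≤ x := by
  rw [← sub_nonpos, HomeoTilde.sub_fract, sub_nonpos]
  rcases (Int.fract_nonneg x).eq_or_lt with h | h
  · rw [← h, uTilde_zero]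
  · exact (uTilde_lt ⟨h, Int.fract_lt_one x⟩ hy).le

lemma le_uTilde {y : ℝ} (hy : y < 0) (x : ℝ) : x ≤ (uTilde y : HomeoTilde) x := by
  rw [← sub_nonneg, HomeoTilde.sub_fract, sub_nonneg]
  rcases (Int.fract_nonneg x).eq_or_lt with h | h
  · rw [← h, uTilde_zero]
  · exact (lt_uTilde ⟨h, Int.fract_lt_one x⟩ hy).le

lemma exists_aTilde_lt (l : Set.Ioi (1 : ℝ)) : ∃ x, (aTilde l : HomeoTilde) x < x := by
  have hl : 1 < (l : ℝ) := l.2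
  have h1 : (l : ℝ)⁻¹ < 1 := inv_lt_one_of_one_lt₀ hl
  -- The displacement has the sign of `-cos πx`; the points `1/4` and, in the next lemma, `3/4` lie
  -- on either side of the fixed vertical line at `1/2`.
  refine ⟨1 / 4, canonicalLift_upper_lt (by simp [aMat]) ?_ (by norm_num) ?_⟩
  · simp [aMat]; linarith
  · have hc : 0 < Real.cos (Real.pi * (1 / 4)) := by
      rw [show Real.pi * (1 / 4) = Real.pi / 4 by ring, Real.cos_pi_div_four]; positivity
    simpa [aMat] using mul_neg_of_neg_of_pos (sub_neg.2 (h1.trans hl)) hc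

lemma exists_lt_aTilde (l : Set.Ioi (1 : ℝ)) : ∃ x, x < (aTilde l : HomeoTilde) x := by
  have hl : 1 < (l : ℝ) := l.2
  have h1 : (l : ℝ)⁻¹ < 1 := inv_lt_one_of_one_lt₀ hl
  refine ⟨3 / 4, lt_canonicalLift_upper (by simp [aMat]) ?_ (by norm_num) ?_⟩
  · simp [aMat]; linarith
  · have hc : Real.cos (Real.pi * (3 / 4)) < 0 := by
      rw [show Real.pi * (3 / 4) = Real.pi - Real.pi / 4 by ring, Real.cos_pi_sub,
        Real.cos_pi_div_four]
      exact neg_neg_of_pos (by positivity)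
    simpa [aMat] using mul_pos_of_neg_of_neg (sub_neg.2 (h1.trans hl)) hc

lemma isLift_trans_rhoMat (θ : ℝ) : IsLift (trans (θ / Real.pi)) (rhoMat θ : PSL(2, ℝ)) := by
  intro x
  have hpi := Real.pi_pos
  rw [Matrix.ProjectiveSpecialLinearGroup.smul_proj_mk]
  unfold linePt
  rw [Projectivization.smul_mk, Projectivization.mk_eq_mk_iff']
  have e : Real.pi * trans (θ / Real.pi) x = θ + Real.pi * x := by
    rw [trans_apply]; field_simp
  refine ⟨1, ?_⟩
  rw [e, Real.cos_add, Real.sin_add, Matrix.SpecialLinearGroup.smul_def]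
  ext i
  fin_cases i <;>
  simp [rhoMat] <;> ring

lemma rhoTilde_eq_trans (θ : Set.Ioo (0 : ℝ) Real.pi) :
    (rhoTilde θ : HomeoTilde) = trans (θ / Real.pi) := by
  let α : SLTilde := ⟨trans (θ / Real.pi), _, isLift_trans_rhoMat θ⟩
  have h : IsCanonicalLift (rhoMat θ : PSL(2, ℝ)) α := by
    refine ⟨isLift_trans_rhoMat θ, ?_⟩
    change θ / Real.pi + 0 ∈ Set.Ico (0 : ℝ) 1
    rw [add_zero]
    exact ⟨(div_pos θ.2.1 Real.pi_pos).le, (div_lt_one Real.pi_pos).2 θ.2.2⟩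
  exact congrArg Subtype.val (eq_canonicalLift h).symm

lemma rhoTilde_apply (θ : Set.Ioo (0 : ℝ) Real.pi) (x : ℝ) :
    (rhoTilde θ : HomeoTilde) x = θ / Real.pi + x := by
  rw [rhoTilde_eq_trans, trans_apply]

/-! ### The listed representatives -/

lemma ClassLabel.profile_rep (c : ClassLabel) : c.Profile c.rep := by
  have abs_u (y x : ℝ) : |(uTilde y : HomeoTilde) x - x| < 1 :=
    canonicalLift_upper_abs_lt (by simp [uMat]) x
  have half : (1 / 2 : ℝ) ∈ Set.Ioo (0 : ℝ) 1 := by norm_num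
  cases c with
  | central k => exact fun x => add_comm _ _
  | uPlus k =>
    simp only [Profile, rep, T_mul_apply]
    push_cast
    refine ⟨fun x => ?_, fun x => ?_, ⟨0, ?_⟩, 1 / 2, ?_⟩
    · linarith [(abs_lt.1 (abs_u 1 x)).1]
    · linarith [uTilde_le zero_lt_one x]
    · rw [uTilde_zero, add_comm]
    · linarith [uTilde_lt half zero_lt_one]
  | uMinus k =>
    simp only [Profile, rep, T_mul_apply]
    push_cast
    refine ⟨fun x => ?_, fun x => ?_, ⟨0, ?_⟩, 1 / 2, ?_⟩
    · linarith [(abs_lt.1 (abs_u (-1) x)).2]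
    · linarith [le_uTilde neg_one_lt_zero x]
    · rw [uTilde_zero, add_comm]
    · linarith [lt_uTilde half neg_one_lt_zero]
  | hyperbolic k l =>
    have abs_a (x : ℝ) : |(aTilde l : HomeoTilde) x - x| < 1 :=
      canonicalLift_upper_abs_lt (by simp [aMat]) x
    obtain ⟨y, hy⟩ := exists_aTilde_lt l
    obtain ⟨z, hz⟩ := exists_lt_aTilde l
    simp only [Profile, rep, T_mul_apply]
    push_cast
    refine ⟨fun x => ?_, fun x => ?_, ⟨y, ?_⟩, z, ?_⟩
    · linarith [(abs_lt.1 (abs_a x)).1]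
    · linarith [(abs_lt.1 (abs_a x)).2]
    · linarith
    · linarith
  | elliptic k θ =>
    have h0 := div_pos θ.2.1 Real.pi_pos
    have h1 := (div_lt_one Real.pi_pos).2 θ.2.2
    simp only [Profile, rep, T_mul_apply, rhoTilde_apply]
    push_cast
    constructor <;> intro x <;> linarith

/-- This is what distinguishes the angles `θ` and `π - θ`. -/
lemma tau_T_mul_rhoTilde (k : ℤ) (θ : Set.Ioo (0 : ℝ) Real.pi) :
    tau (T k * rhoTilde θ : SLTilde) = k + θ / Real.pi := by
  have : ((T k * rhoTilde θ : SLTilde) : HomeoTilde) = trans (k + θ / Real.pi) :=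
    HomeoTilde.ext fun x => by
      rw [T_mul_apply, rhoTilde_apply, trans_apply, add_assoc]
  rw [this]
  exact CircleDeg1Lift.translationNumber_translate _

lemma tau_eq_of_isConj {α β : SLTilde} (h : IsConj α β) : tau α = tau β := by
  obtain ⟨c, rfl⟩ := isConj_iff.1 h
  exact (CircleDeg1Lift.translationNumber_conj_eq (c : HomeoTilde) (α : HomeoTilde)).symm

/-- The trace of the class with the given label. -/
noncomputable def ClassLabel.trace : ClassLabel → ℝ
  | hyperbolic _ l => l + 1 / l
  | elliptic _ θ => 2 * |Real.cos θ|
  | _ => 2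

lemma ClassLabel.absTrace_rep (c : ClassLabel) : absTrace (image c.rep) = c.trace := by
  have key (k : ℤ) (M : SL(2, ℝ)) : absTrace (image (T k * canonicalLift (M : PSL(2, ℝ)))) =
      |M 0 0 + M 1 1| := by
    rw [image_eq ((canonicalLift_spec (M : PSL(2, ℝ))).1.T_mul k), absTrace_coe,
      Matrix.trace_fin_two]
  cases c with
  | central k =>
    have := key k 1
    rw [QuotientGroup.mk_one, canonicalLift_one, mul_one] at this
    rw [rep, this]
    norm_num [trace]
  | uPlus k =>
    refine (key k (uMat 1)).trans ?_
    norm_num [uMat, trace]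
  | uMinus k =>
    refine (key k (uMat (-1))).trans ?_
    norm_num [uMat, trace]
  | hyperbolic k l =>
    have hl : 0 < (l : ℝ) := zero_lt_one.trans l.2
    refine (key k (aMat l hl)).trans ?_
    simp only [aMat, trace]
    exact abs_of_pos (by simp; positivity)
  | elliptic k θ =>
    refine (key k (rhoMat θ)).trans ?_
    simp only [rhoMat, trace]
    simp [← two_mul, abs_mul]

/-! ### Normal forms in `PSL(2, ℝ)` -/

lemma coe_neg_eq (M : SL(2, ℝ)) : ((-M : SL(2, ℝ)) : PSL(2, ℝ)) = M := by
  rw [eq_comm]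
  refine QuotientGroup.eq.2 (Subgroup.mem_center_iff.2 fun N => ?_)
  simp

/-- The form `M * P = P * C` avoids inverses: the columns of `P` are a basis in which `M` acts as
`C`. -/
lemma isConj_coe_of_mul_eq {M C : SL(2, ℝ)} (P : SL(2, ℝ)) (h : M * P = P * C) :
    IsConj (M : PSL(2, ℝ)) (C : PSL(2, ℝ)) := by
  have : IsConj M C := isConj_iff.2 ⟨P⁻¹, by rw [inv_inv, mul_assoc, h, inv_mul_cancel_left]⟩
  exact (QuotientGroup.mk' (Subgroup.center SL(2, ℝ))).map_isConj this

/-- `g` is conjugate to the image of one of the listed matrices. -/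
def HasNormalForm (g : PSL(2, ℝ)) : Prop :=
  IsConj g 1 ∨ IsConj g (uMat 1) ∨ IsConj g (uMat (-1)) ∨
    (∃ l : Set.Ioi (1 : ℝ), IsConj g (aMat l (zero_lt_one.trans l.2))) ∨
    ∃ θ : Set.Ioo (0 : ℝ) Real.pi, IsConj g (rhoMat θ)

lemma HasNormalForm.of_isConj {g h : PSL(2, ℝ)} (hg : HasNormalForm g) (hc : IsConj h g) :
    HasNormalForm h := by
  rcases hg with hg | hg | hg | ⟨l, hg⟩ | ⟨θ, hg⟩
  · exact Or.inl (hc.trans hg)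
  · exact Or.inr (Or.inl (hc.trans hg))
  · exact Or.inr (Or.inr (Or.inl (hc.trans hg)))
  · exact Or.inr (Or.inr (Or.inr (Or.inl ⟨l, hc.trans hg⟩)))
  · exact Or.inr (Or.inr (Or.inr (Or.inr ⟨θ, hc.trans hg⟩)))

lemma sl_ext {M N : SL(2, ℝ)} (h00 : M 0 0 = N 0 0) (h01 : M 0 1 = N 0 1) (h10 : M 1 0 = N 1 0)
    (h11 : M 1 1 = N 1 1) : M = N := by
  ext i j
  fin_cases i <;> fin_cases j <;> assumption

lemma det_eq (M : SL(2, ℝ)) : M 0 0 * M 1 1 - M 0 1 * M 1 0 = 1 := by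
  have := M.2
  rwa [Matrix.det_fin_two] at this

/-- The matrix with the given entries. -/
def slMk (a b c d : ℝ) (h : a * d - b * c = 1) : SL(2, ℝ) :=
  ⟨!![a, b; c, d], by rw [Matrix.det_fin_two_of, h]⟩

@[simp] lemma slMk_00 {a b c d : ℝ} (h) : slMk a b c d h 0 0 = a := rfl
@[simp] lemma slMk_01 {a b c d : ℝ} (h) : slMk a b c d h 0 1 = b := rfl
@[simp] lemma slMk_10 {a b c d : ℝ} (h) : slMk a b c d h 1 0 = c := rfl
@[simp] lemma slMk_11 {a b c d : ℝ} (h) : slMk a b c d h 1 1 = d := rfl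

lemma isConj_coe_of_entries {M C : SL(2, ℝ)} (P : SL(2, ℝ))
    (h00 : M 0 0 * P 0 0 + M 0 1 * P 1 0 = P 0 0 * C 0 0 + P 0 1 * C 1 0)
    (h01 : M 0 0 * P 0 1 + M 0 1 * P 1 1 = P 0 0 * C 0 1 + P 0 1 * C 1 1)
    (h10 : M 1 0 * P 0 0 + M 1 1 * P 1 0 = P 1 0 * C 0 0 + P 1 1 * C 1 0)
    (h11 : M 1 0 * P 0 1 + M 1 1 * P 1 1 = P 1 0 * C 0 1 + P 1 1 * C 1 1) :
    IsConj (M : PSL(2, ℝ)) (C : PSL(2, ℝ)) := by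
  refine isConj_coe_of_mul_eq P (sl_ext ?_ ?_ ?_ ?_) <;> simpa only [sl_mul_apply]

lemma hasNormalForm_of_upper_of_pos {M : SL(2, ℝ)} (h10 : M 1 0 = 0) (h00 : 0 < M 0 0) :
    HasNormalForm M := by
  have hd := det_eq M
  rw [h10, mul_zero, sub_zero] at hd
  have h11 : M 1 1 = 1 / M 0 0 := by field_simp; linarith
  rcases lt_trichotomy (M 0 0) 1 with ha | ha | ha
  · have hne : 1 - M 0 0 ^ 2 ≠ 0 := by nlinarith
    have hl : 1 < 1 / M 0 0 := by rwa [one_lt_div h00]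
    refine Or.inr (Or.inr (Or.inr (Or.inl ⟨⟨1 / M 0 0, hl⟩, ?_⟩)))
    -- The columns are eigenvectors for `1 / M 0 0` and `M 0 0`, the larger eigenvalue first; the
    -- entry `-1` makes the determinant one.
    refine isConj_coe_of_entries
      (slMk (M 0 1 * M 0 0 / (1 - M 0 0 ^ 2)) (-1) 1 0 (by ring)) ?_ ?_ ?_ ?_
    all_goals simp [aMat, h10, h11]
    field_simp
    ring
  · rw [ha, div_one] at h11
    rcases lt_trichotomy (M 0 1) 0 with hb | hb | hb
    · have hs : √(-M 0 1) ≠ 0 := (Real.sqrt_pos.2 (by linarith)).ne'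
      have hsq : √(-M 0 1) ^ 2 = -M 0 1 := Real.sq_sqrt (by linarith)
      refine Or.inr (Or.inr (Or.inl ?_))
      -- Conjugation by a diagonal matrix multiplies the off-diagonal entry by a positive square, so
      -- it can be normalised to `-1` but its sign stays.
      refine isConj_coe_of_entries
        (slMk (√(-M 0 1)) 0 0 (1 / √(-M 0 1)) (by field_simp; ring)) ?_ ?_ ?_ ?_
      all_goals simp [uMat, h10, h11, ha]
      field_simp
      linarith
    · left
      have : M = 1 := sl_ext (by simp [ha]) (by simp [hb]) (by simp [h10]) (by simp [h11])
      rw [this]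
      rfl
    · have hs : √(M 0 1) ≠ 0 := (Real.sqrt_pos.2 hb).ne'
      have hsq : √(M 0 1) ^ 2 = M 0 1 := Real.sq_sqrt hb.le
      refine Or.inr (Or.inl ?_)
      refine isConj_coe_of_entries
        (slMk (√(M 0 1)) 0 0 (1 / √(M 0 1)) (by field_simp; ring)) ?_ ?_ ?_ ?_
      all_goals simp [uMat, h10, h11, ha]
      field_simp
      linarith
  · have hne : 1 - M 0 0 ^ 2 ≠ 0 := by nlinarith
    refine Or.inr (Or.inr (Or.inr (Or.inl ⟨⟨M 0 0, ha⟩, ?_⟩)))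
    refine isConj_coe_of_entries
      (slMk 1 (M 0 1 * M 0 0 / (1 - M 0 0 ^ 2)) 0 1 (by ring)) ?_ ?_ ?_ ?_
    all_goals simp [aMat, h10, h11]
    field_simp
    ring

lemma hasNormalForm_of_upper {M : SL(2, ℝ)} (h10 : M 1 0 = 0) : HasNormalForm M := by
  have hd := det_eq M
  rw [h10, mul_zero, sub_zero] at hd
  rcases lt_trichotomy (M 0 0) 0 with h | h | h
  · rw [← coe_neg_eq]
    exact hasNormalForm_of_upper_of_pos (by simp [h10]) (by simpa using h)
  · simp [h] at hd
  · exact hasNormalForm_of_upper_of_pos h10 h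

/-- The angle is `arccos` of half the trace. Its sine is positive, which matches a positive lower
left entry; the other sign is reached through `-M`. -/
lemma hasNormalForm_of_elliptic {M : SL(2, ℝ)} (h10 : 0 < M 1 0)
    (ht : |M 0 0 + M 1 1| < 2) : HasNormalForm M := by
  have hd := det_eq M
  set t := (M 0 0 + M 1 1) / 2 with ht'
  obtain ⟨hl, hr⟩ := abs_lt.1 ht
  have h1 : -1 < t := by linarith
  have h2 : t < 1 := by linarith
  have hpos : 0 < 1 - t ^ 2 := by nlinarith
  have hθ : Real.arccos t ∈ Set.Ioo (0 : ℝ) Real.pi := by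
    refine ⟨Real.arccos_pos.2 h2, lt_of_le_of_ne (Real.arccos_le_pi t) fun h => ?_⟩
    exact absurd (Real.arccos_eq_pi.1 h) (not_le.2 h1)
  have hcos : Real.cos (Real.arccos t) = t := Real.cos_arccos h1.le h2.le
  have hsin : Real.sin (Real.arccos t) = √(1 - t ^ 2) := Real.sin_arccos t
  set s := √(1 - t ^ 2)
  have hs : 0 < s := Real.sqrt_pos.2 hpos
  have hs2 : s ^ 2 = 1 - t ^ 2 := Real.sq_sqrt hpos.le
  set w := √(s / M 1 0)
  have hw2 : w ^ 2 = s / M 1 0 := Real.sq_sqrt (by positivity)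
  have hw2' : w ^ 2 * M 1 0 = s := by rw [hw2]; field_simp
  refine Or.inr (Or.inr (Or.inr (Or.inr ⟨⟨Real.arccos t, hθ⟩, ?_⟩)))
  -- With first column `(w, 0)`, the relation `M p₁ = cos θ p₁ + sin θ p₂` forces the second column,
  -- and determinant one forces `w ^ 2 = s / M 1 0`.
  refine isConj_coe_of_entries
    (slMk w (w * (M 0 0 - t) / s) 0 (w * M 1 0 / s) (by field_simp; linarith)) ?_ ?_ ?_ ?_
  all_goals simp [rhoMat, hcos, hsin]
  · field_simp
    ring
  · field_simp
    rw [hs2]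
    have : M 1 1 = 2 * t - M 0 0 := by rw [ht']; ring
    rw [this] at hd
    linear_combination (-w) * hd
  · field_simp
  · field_simp
    rw [ht']
    ring

lemma hasNormalForm (g : PSL(2, ℝ)) : HasNormalForm g := by
  induction g using QuotientGroup.induction_on with | _ M =>
  have hd := det_eq M
  rcases lt_or_ge |M 0 0 + M 1 1| 2 with ht | ht
  · rcases lt_trichotomy (M 1 0) 0 with h | h | h
    · rw [← coe_neg_eq]
      refine hasNormalForm_of_elliptic (by simpa using h) ?_
      have e : (-M) 0 0 + (-M) 1 1 = -(M 0 0 + M 1 1) := by simp; ring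
      rwa [e, abs_neg]
    · exact hasNormalForm_of_upper h
    · exact hasNormalForm_of_elliptic h ht
  · by_cases h : M 1 0 = 0
    · exact hasNormalForm_of_upper h
    -- The roots are those `x` for which `(x, 1)` is an eigenvector; the discriminant is the squared
    -- trace minus four. With that vector as first column of `P` the matrix becomes upper
    -- triangular.
    · obtain ⟨x, hx⟩ : ∃ x, M 1 0 * (x * x) + (M 1 1 - M 0 0) * x + -M 0 1 = 0 := by
        refine exists_quadratic_eq_zero h ⟨√((M 0 0 + M 1 1) ^ 2 - 4), ?_⟩
        rw [Real.mul_self_sqrt (by nlinarith [sq_abs (M 0 0 + M 1 1)]), discrim]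
        linear_combination (-4 : ℝ) * hd
      refine (hasNormalForm_of_upper (M := slMk (M 1 0 * x + M 1 1) (-M 1 0) 0
        (M 0 0 - M 1 0 * x) ?_) rfl).of_isConj
          (isConj_coe_of_entries (slMk x (-1) 1 0 (by ring)) ?_ ?_ ?_ ?_)
      · linear_combination hd - M 1 0 * hx
      all_goals simp
      all_goals first | ring1 | linear_combination hx | linear_combination -hx

/-! ### The classification -/

lemma exists_isConj_rep (α : SLTilde) : ∃ c : ClassLabel, IsConj α c.rep := by
  rcases hasNormalForm (image α) with h | h | h | ⟨l, h⟩ | ⟨θ, h⟩ <;>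
    obtain ⟨k, hk⟩ := exists_isConj_T_mul h
  · rw [canonicalLift_one, mul_one] at hk
    exact ⟨.central k, hk⟩
  · exact ⟨.uPlus k, hk⟩
  · exact ⟨.uMinus k, hk⟩
  · exact ⟨.hyperbolic k l, hk⟩
  · exact ⟨.elliptic k θ, hk⟩

lemma ClassLabel.invariants {c : ClassLabel} {α : SLTilde} (h : IsConj α c.rep) :
    absTrace (image α) = c.trace ∧ (¬ c.IsCentral → directionType α = some c.direction) ∧
      lengthSharp α = c.lengthClass := by
  have hp : c.Profile α := c.profile_rep.of_isConj h.symm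
  exact ⟨(absTrace_eq_of_isConj (isConj_image h)).trans c.absTrace_rep, hp.directionType_eq,
    hp.lengthSharp_eq⟩

lemma classHasLengthSharp {α : SLTilde} {s : RSharp} (c : ClassLabel) (hc : α = c.rep)
    (hs : c.lengthClass = s) : ClassHasLengthSharp α s := fun β h => by
  rw [← hs]
  exact (ClassLabel.invariants (hc ▸ h).symm).2.2

lemma eq_T_zero_mul (α : SLTilde) : α = T 0 * α := by rw [T_zero, one_mul]

lemma T_mem_center (k : ℤ) : T k ∈ Subgroup.center SLTilde :=
  Subgroup.mem_center_iff.2 fun α => (T_mul_comm k α).symm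

/-- A central element is conjugate only to itself. -/
lemma not_isCentral_of_isConj {c : ClassLabel} {α : SLTilde} (hα : α ∉ Subgroup.center SLTilde)
    (h : IsConj α c.rep) : ¬ c.IsCentral := by
  cases c with
  | central k =>
    obtain ⟨γ, hγ⟩ := isConj_iff.1 h.symm
    rw [ClassLabel.rep, ← T_mul_comm, mul_inv_cancel_right] at hγ
    exact absurd (hγ ▸ T_mem_center k) hα
  | _ => exact id

/-! ### Separating labels by trace, direction and length -/

lemma two_lt_add_one_div (l : Set.Ioi (1 : ℝ)) : 2 < (l : ℝ) + 1 / l := by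
  have hl : 1 < (l : ℝ) := l.2
  have h0 : 0 < (l : ℝ) := by linarith
  rw [← sub_pos]
  have : (l : ℝ) + 1 / l - 2 = (l - 1) ^ 2 / l := by field_simp; ring
  rw [this]
  exact div_pos (pow_pos (by linarith) 2) h0

lemma add_one_div_injective {l m : Set.Ioi (1 : ℝ)} (h : (l : ℝ) + 1 / l = m + 1 / m) :
    l = m := by
  have hl : 1 < (l : ℝ) := l.2
  have hm : 1 < (m : ℝ) := m.2
  have h0 : (l : ℝ) ≠ 0 := by linarith
  have h1 : (m : ℝ) ≠ 0 := by linarith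
  field_simp at h
  have : ((l : ℝ) - m) * (l * m - 1) = 0 := by linear_combination h
  rcases mul_eq_zero.1 this with h | h
  · exact Subtype.ext (sub_eq_zero.1 h)
  · nlinarith

lemma two_mul_abs_cos_lt_two (θ : Set.Ioo (0 : ℝ) Real.pi) : 2 * |Real.cos θ| < 2 := by
  have hs := Real.sin_pos_of_pos_of_lt_pi θ.2.1 θ.2.2
  have := Real.sin_sq_add_cos_sq (θ : ℝ)
  have : |Real.cos θ| < 1 := by
    rw [← sq_lt_one_iff_abs_lt_one]
    nlinarith
  linarith

lemma eq_or_eq_mirror {θ φ : Set.Ioo (0 : ℝ) Real.pi} (h : |Real.cos θ| = |Real.cos φ|) :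
    φ = θ ∨ φ = mirror θ := by
  rcases abs_eq_abs.1 h with h | h
  · exact Or.inl (Subtype.ext (Real.injOn_cos (Set.Ioo_subset_Icc_self φ.2)
      (Set.Ioo_subset_Icc_self θ.2) h.symm))
  · refine Or.inr (Subtype.ext (Real.injOn_cos (Set.Ioo_subset_Icc_self φ.2)
      (Set.Ioo_subset_Icc_self (mirror θ).2) ?_))
    rw [mirror, Real.cos_pi_sub, h, neg_neg]

lemma sign_eq_sign_iff_int {m n : ℤ} (h : SignType.sign m = SignType.sign n) :
    (0 < m ↔ 0 < n) ∧ (m < 0 ↔ n < 0) := by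
  rw [← sign_eq_one_iff, ← sign_eq_one_iff, ← sign_eq_neg_one_iff, ← sign_eq_neg_one_iff, h]
  exact ⟨Iff.rfl, Iff.rfl⟩

/-- The three invariants determine the label of a non-central class up to mirroring the angle. -/
lemma ClassLabel.eq_or_mirror_of_invariants {c d : ClassLabel} (hc : ¬ c.IsCentral)
    (hd : ¬ d.IsCentral) (ht : c.trace = d.trace) (hdir : c.direction = d.direction)
    (hl : c.lengthClass = d.lengthClass) :
    c = d ∨ ∃ k θ, c = elliptic k θ ∧ d = elliptic k (mirror θ) := by
  have hne (m n : ℤ) : sharpIoo m ≠ sharpInt n := (sharpInt_ne_sharpIoo n m).symm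
  cases c with
  | central k => exact absurd trivial hc
  | uPlus k =>
    cases d with
    | central k' => exact absurd trivial hd
    | uPlus k' =>
      left
      simp only [direction, lengthClass] at hdir hl
      split_ifs at hdir <;> split_ifs at hl <;>
        simp_all [sharpInt_injective.eq_iff, sharpIoo_injective.eq_iff, sharpInt_ne_sharpIoo]
    | uMinus k' =>
      -- Equal directions force `k` and `k'` to be non-zero of the same sign; then one of the two
      -- lengths is an integer class and the other an interval class.
      exfalso
      simp only [direction, lengthClass] at hdir hl
      split_ifs at hdir
      · simp at hdir
      · simp at hdir
      · simp at hdir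
      · have := sign_eq_sign_iff_int (Prod.mk.inj hdir).2
        split_ifs at hl
        · omega
        · exact sharpInt_ne_sharpIoo _ _ hl
        · exact hne _ _ hl
        · omega
    | hyperbolic k' l => exact absurd ht (two_lt_add_one_div l).ne
    | elliptic k' θ => exact absurd ht (two_mul_abs_cos_lt_two θ).ne'
  | uMinus k =>
    cases d with
    | central k' => exact absurd trivial hd
    | uPlus k' =>
      exfalso
      simp only [direction, lengthClass] at hdir hl
      split_ifs at hdir
      · simp at hdir
      · simp at hdir
      · simp at hdir
      · have := sign_eq_sign_iff_int (Prod.mk.inj hdir).2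
        split_ifs at hl
        · omega
        · exact sharpInt_ne_sharpIoo _ _ hl
        · exact hne _ _ hl
        · omega
    | uMinus k' =>
      left
      simp only [direction, lengthClass] at hdir hl
      split_ifs at hdir <;> split_ifs at hl <;>
        simp_all [sharpInt_injective.eq_iff, sharpIoo_injective.eq_iff, sharpInt_ne_sharpIoo]
    | hyperbolic k' l => exact absurd ht (two_lt_add_one_div l).ne
    | elliptic k' θ => exact absurd ht (two_mul_abs_cos_lt_two θ).ne'
  | hyperbolic k l =>
    cases d with
    | central k' => exact absurd trivial hd
    | uPlus k' => exact absurd ht (two_lt_add_one_div l).ne'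
    | uMinus k' => exact absurd ht (two_lt_add_one_div l).ne'
    | hyperbolic k' l' =>
      left
      rw [add_one_div_injective ht]
      -- The length gives `|k| = |k'|` and the direction gives the sign.
      have hk := abs_eq_abs.1 (sharpIoo_injective hl)
      have : k = k' := by
        simp only [direction] at hdir
        split_ifs at hdir
        · omega
        · omega
        · omega
        · have := sign_eq_sign_iff_int (Prod.mk.inj hdir).2
          omega
      rw [this]
    | elliptic k' θ =>
      exact absurd ht ((two_mul_abs_cos_lt_two θ).trans (two_lt_add_one_div l)).ne'
  | elliptic k θ =>
    cases d with
    | central k' => exact absurd trivial hd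
    | uPlus k' => exact absurd ht (two_mul_abs_cos_lt_two θ).ne
    | uMinus k' => exact absurd ht (two_mul_abs_cos_lt_two θ).ne
    | hyperbolic k' l =>
      exact absurd ht ((two_mul_abs_cos_lt_two θ).trans (two_lt_add_one_div l)).ne
    | elliptic k' φ =>
      have hcos : |Real.cos θ| = |Real.cos φ| := by
        simp only [trace] at ht
        linarith
      -- The direction tells `k ≥ 0` from `k ≤ -1`; on each side the length, `k` or `-1 - k`, is
      -- injective in `k`.
      have : k = k' := by
        simp only [direction, lengthClass] at hdir hl
        split_ifs at hdir hl
        · exact sharpIoo_injective hl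
        · simp at hdir
        · simp at hdir
        · have := sharpIoo_injective hl
          omega
      subst this
      rcases eq_or_eq_mirror hcos with rfl | rfl
      · exact Or.inl rfl
      · exact Or.inr ⟨k, θ, rfl, rfl⟩

/-- A constant integer displacement fits no other profile: the unipotent and hyperbolic ones need
two different comparisons with `x + k'`, and the elliptic one lies strictly between integers. -/
lemma ClassLabel.Profile.eq_central {c : ClassLabel} {k : ℤ} {α : HomeoTilde}
    (h : (central k).Profile α) (hc : c.Profile α) : c = central k := by
  have key (m n : ℤ) (x : ℝ) : (x + m < x + n ↔ m < n) ∧ (x + m ≤ x + n ↔ m ≤ n) ∧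
      ((x : ℝ) + m = x + n ↔ m = n) := by
    refine ⟨?_, ?_, ?_⟩ <;> simp
  cases c with
  | central k' =>
    have := (h 0).symm.trans (hc 0)
    rw [(key _ _ _).2.2] at this
    rw [this]
  | uPlus k' =>
    obtain ⟨-, -, ⟨y, hy⟩, z, hz⟩ := hc
    rw [h y, (key _ _ _).2.2] at hy
    rw [h z, (key _ _ _).1] at hz
    omega
  | uMinus k' =>
    obtain ⟨-, -, ⟨y, hy⟩, z, hz⟩ := hc
    rw [h y, (key _ _ _).2.2] at hy
    rw [h z, (key _ _ _).1] at hz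
    omega
  | hyperbolic k' l =>
    obtain ⟨-, -, ⟨y, hy⟩, z, hz⟩ := hc
    rw [h y, (key _ _ _).1] at hy
    rw [h z, (key _ _ _).1] at hz
    omega
  | elliptic k' θ =>
    have h1 := hc.1 0
    have h2 := hc.2 0
    rw [h 0, (key _ _ _).1] at h1 h2
    omega

lemma ClassLabel.eq_of_isConj {c d : ClassLabel} (h : IsConj c.rep d.rep) : c = d := by
  have hp : c.Profile d.rep := c.profile_rep.of_isConj h
  -- Central labels are recognised by their profile, since the direction formula is available only
  -- for the others.
  by_cases hc : c.IsCentral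
  · cases c with
    | central k => exact (hp.eq_central d.profile_rep).symm
    | _ => exact hc.elim
  by_cases hd : d.IsCentral
  · cases d with
    | central k => exact (profile_rep (central k)).eq_central hp
    | _ => exact hd.elim
  obtain ⟨t1, d1, l1⟩ := ClassLabel.invariants h
  obtain ⟨t2, d2, l2⟩ := ClassLabel.invariants (IsConj.refl c.rep)
  rcases eq_or_mirror_of_invariants hc hd (t2.symm.trans t1)
    (Option.some.inj ((d2 hc).symm.trans (d1 hd))) (l2.symm.trans l1) with h' | ⟨k, θ, rfl, rfl⟩
  · exact h'
  -- Mirror angles agree in all three invariants; the translation number forces `θ = π - θ`, so the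
  -- labels coincide.
  · have ht := tau_eq_of_isConj h
    rw [rep, rep, tau_T_mul_rhoTilde, tau_T_mul_rhoTilde, add_right_inj,
      div_left_inj' Real.pi_ne_zero] at ht
    exact congrArg (elliptic k) (Subtype.ext ht)

lemma bijective_classes : Function.Bijective fun c : ClassLabel => ConjClasses.mk c.rep := by
  refine ⟨fun c d h => ClassLabel.eq_of_isConj (ConjClasses.mk_eq_mk_iff_isConj.1 h), fun a => ?_⟩
  obtain ⟨α, rfl⟩ := ConjClasses.mk_surjective a
  obtain ⟨c, hc⟩ := exists_isConj_rep α
  exact ⟨c, ConjClasses.mk_eq_mk_iff_isConj.2 hc.symm⟩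

lemma sameInvariants_of_labels {c d : ClassLabel} {α β : SLTilde} (hα : IsConj α c.rep)
    (hβ : IsConj β d.rep) (hc : ¬ c.IsCentral) (hd : ¬ d.IsCentral) :
    SameInvariants α β ↔ c.trace = d.trace ∧ c.direction = d.direction ∧
      c.lengthClass = d.lengthClass := by
  obtain ⟨t1, d1, l1⟩ := ClassLabel.invariants hα
  obtain ⟨t2, d2, l2⟩ := ClassLabel.invariants hβ
  rw [SameInvariants, t1, t2, d1 hc, d2 hd, l1, l2, Option.some_inj]

lemma isConj_iff_sameInvariants {α β : SLTilde} (hα : α ∉ Subgroup.center SLTilde)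
    (hβ : β ∉ Subgroup.center SLTilde) (hα2 : 2 ≤ absTrace (image α)) :
    IsConj α β ↔ SameInvariants α β := by
  obtain ⟨c, hc⟩ := exists_isConj_rep α
  obtain ⟨d, hd⟩ := exists_isConj_rep β
  have hc' := not_isCentral_of_isConj hα hc
  have hd' := not_isCentral_of_isConj hβ hd
  constructor
  · intro h
    exact (sameInvariants_of_labels hc (h.symm.trans hc) hc' hc').2 ⟨rfl, rfl, rfl⟩
  · intro h
    obtain ⟨h1, h2, h3⟩ := (sameInvariants_of_labels hc hd hc' hd').1 h
    rcases ClassLabel.eq_or_mirror_of_invariants hc' hd' h1 h2 h3 with rfl | ⟨k, θ, rfl, rfl⟩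
    · exact hc.trans hd.symm
    · rw [(ClassLabel.invariants hc).1] at hα2
      exact absurd (two_mul_abs_cos_lt_two θ) (not_lt.2 hα2)

lemma ClassLabel.exists_elliptic_of_trace_lt_two {c : ClassLabel} (h : c.trace < 2) :
    ∃ k θ, c = elliptic k θ := by
  cases c with
  | elliptic k θ => exact ⟨k, θ, rfl⟩
  | hyperbolic k l => exact absurd h (two_lt_add_one_div l).not_gt
  | _ => exact absurd h (lt_irrefl _)

/-- Only elliptic labels have trace below two, and mirroring the angle changes only the sign of the
cosine. -/
lemma sameInvariants_iff_of_absTrace_lt_two {α β : SLTilde} (hα : absTrace (image α) < 2) :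
    SameInvariants α β ↔ ∃ (k : ℤ) (θ : Set.Ioo (0 : ℝ) Real.pi),
      IsConj α (T k * rhoTilde θ) ∧
        (IsConj β (T k * rhoTilde θ) ∨ IsConj β (T k * rhoTilde (mirror θ))) := by
  have nc (k : ℤ) (θ : Set.Ioo (0 : ℝ) Real.pi) : ¬ (ClassLabel.elliptic k θ).IsCentral := id
  constructor
  · intro h
    obtain ⟨c, hc⟩ := exists_isConj_rep α
    obtain ⟨d, hd⟩ := exists_isConj_rep β
    have hβ : absTrace (image β) < 2 := h.1 ▸ hα
    rw [(ClassLabel.invariants hc).1] at hα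
    rw [(ClassLabel.invariants hd).1] at hβ
    obtain ⟨k, θ, rfl⟩ := ClassLabel.exists_elliptic_of_trace_lt_two hα
    obtain ⟨k', φ, rfl⟩ := ClassLabel.exists_elliptic_of_trace_lt_two hβ
    obtain ⟨h1, h2, h3⟩ := (sameInvariants_of_labels hc hd (nc _ _) (nc _ _)).1 h
    refine ⟨k, θ, hc, ?_⟩
    rcases ClassLabel.eq_or_mirror_of_invariants (nc k θ) (nc k' φ) h1 h2 h3 with
      h' | ⟨m, ψ, h4, h5⟩
    · cases h'
      exact Or.inl hd
    · cases h4
      cases h5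
      exact Or.inr hd
  · rintro ⟨k, θ, hc, hd | hd⟩
    · exact (sameInvariants_of_labels (c := .elliptic k θ) (d := .elliptic k θ) hc hd
        (nc _ _) (nc _ _)).2 ⟨rfl, rfl, rfl⟩
    · refine (sameInvariants_of_labels (c := .elliptic k θ) (d := .elliptic k (mirror θ)) hc hd
        (nc _ _) (nc _ _)).2 ⟨?_, rfl, rfl⟩
      simp only [ClassLabel.trace, mirror, Real.cos_pi_sub, abs_neg]

end SL2Cover

theorem theorem4 :
    -- every conjugacy class is a listed one, and distinct labels give distinct classes
    (Function.Bijective fun c : ClassLabel => ConjClasses.mk c.rep) ∧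
    -- the table of lengths
    (ClassHasLengthSharp 1 (sharpInt 0)) ∧
    (ClassHasLengthSharp (uTilde 1) (sharpIoo 0) ∧
      ClassHasLengthSharp (uTilde (-1)) (sharpIoo 0) ∧
      (∀ l, ClassHasLengthSharp (aTilde l) (sharpIoo 0)) ∧
      (∀ θ, ClassHasLengthSharp (rhoTilde θ) (sharpIoo 0)) ∧
      (∀ θ, ClassHasLengthSharp (T (-1) * rhoTilde θ) (sharpIoo 0))) ∧
    (∀ n : ℤ, 1 ≤ n →
      ClassHasLengthSharp (T n) (sharpInt n) ∧
      ClassHasLengthSharp (T (-n)) (sharpInt n) ∧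
      ClassHasLengthSharp (T n * uTilde 1) (sharpInt n) ∧
      ClassHasLengthSharp (T (-n) * uTilde (-1)) (sharpInt n)) ∧
    (∀ n : ℤ, 1 ≤ n →
      ClassHasLengthSharp (T (-n) * uTilde 1) (sharpIoo n) ∧
      ClassHasLengthSharp (T n * uTilde (-1)) (sharpIoo n) ∧
      (∀ l, ClassHasLengthSharp (T n * aTilde l) (sharpIoo n)) ∧
      (∀ l, ClassHasLengthSharp (T (-n) * aTilde l) (sharpIoo n)) ∧
      (∀ θ, ClassHasLengthSharp (T n * rhoTilde θ) (sharpIoo n)) ∧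
      (∀ θ, ClassHasLengthSharp (T (-1 - n) * rhoTilde θ) (sharpIoo n))) ∧
    -- non-central elements of trace at least two: the three invariants determine the class
    (∀ α β : SLTilde, α ∉ Subgroup.center SLTilde → β ∉ Subgroup.center SLTilde →
      2 ≤ absTrace (image α) → (IsConj α β ↔ SameInvariants α β)) ∧
    -- elements of trace less than two: they determine it up to replacing the angle by its mirror
    (∀ α β : SLTilde, absTrace (image α) < 2 →
      (SameInvariants α β ↔ ∃ (k : ℤ) (θ : Set.Ioo (0 : ℝ) Real.pi),
        IsConj α (T k * rhoTilde θ) ∧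
          (IsConj β (T k * rhoTilde θ) ∨ IsConj β (T k * rhoTilde (mirror θ))))) := by
  refine ⟨bijective_classes, ?_, ⟨?_, ?_, fun l => ?_, fun θ => ?_, fun θ => ?_⟩,
    fun n hn => ⟨?_, ?_, ?_, ?_⟩, fun n hn => ⟨?_, ?_, fun l => ?_, fun l => ?_, fun θ => ?_,
    fun θ => ?_⟩, fun α β hα hβ hα2 => isConj_iff_sameInvariants hα hβ hα2,
    fun α β hα => sameInvariants_iff_of_absTrace_lt_two hα⟩
  · exact classHasLengthSharp (.central 0) T_zero.symm (by simp [ClassLabel.lengthClass])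
  · exact classHasLengthSharp (.uPlus 0) (eq_T_zero_mul _) (by simp [ClassLabel.lengthClass])
  · exact classHasLengthSharp (.uMinus 0) (eq_T_zero_mul _) (by simp [ClassLabel.lengthClass])
  · exact classHasLengthSharp (.hyperbolic 0 l) (eq_T_zero_mul _)
      (by simp [ClassLabel.lengthClass])
  · exact classHasLengthSharp (.elliptic 0 θ) (eq_T_zero_mul _) (by simp [ClassLabel.lengthClass])
  · exact classHasLengthSharp (.elliptic (-1) θ) rfl (by simp [ClassLabel.lengthClass])
  · exact classHasLengthSharp (.central n) rfl
      (by rw [ClassLabel.lengthClass, abs_of_nonneg (by omega)])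
  · exact classHasLengthSharp (.central (-n)) rfl
      (by rw [ClassLabel.lengthClass, abs_neg, abs_of_nonneg (by omega)])
  · exact classHasLengthSharp (.uPlus n) rfl (by rw [ClassLabel.lengthClass, if_pos hn])
  · exact classHasLengthSharp (.uMinus (-n)) rfl
      (by rw [ClassLabel.lengthClass, if_pos (by omega), neg_neg])
  · exact classHasLengthSharp (.uPlus (-n)) rfl
      (by rw [ClassLabel.lengthClass, if_neg (by omega), neg_neg])
  · exact classHasLengthSharp (.uMinus n) rfl (by rw [ClassLabel.lengthClass, if_neg (by omega)])
  · exact classHasLengthSharp (.hyperbolic n l) rfl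
      (by rw [ClassLabel.lengthClass, abs_of_nonneg (by omega)])
  · exact classHasLengthSharp (.hyperbolic (-n) l) rfl
      (by rw [ClassLabel.lengthClass, abs_neg, abs_of_nonneg (by omega)])
  · exact classHasLengthSharp (.elliptic n θ) rfl
      (by rw [ClassLabel.lengthClass, if_pos (by omega)])
  -- The displacements lie in `(-1 - n, -n)`, so the length index is `-1 - (-1 - n) = n`.
  · exact classHasLengthSharp (.elliptic (-1 - n) θ) rfl
      (by rw [ClassLabel.lengthClass, if_neg (by omega), sub_sub_cancel])
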